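/- For an integer $n\ge 2$ and a polynomial $q\in\mathbb{C}[x,z,t]$, let $V_{n,q}\subset\mathbb{A}^4=\operatorname{Spec}\mathbb{C}[x,y,z,t]$ be the closed subscheme defined by $x^n y+z^2+t^3+x\,q(x,z,t)=0$, let $\sigma_{n,q}=\mathrm{pr}_{x,z,t}|_{V_{n,q}}:V_{n,q}\to\mathbb{A}^3=\operatorname{Spec}\mathbb{C}[x,z,t]$ be the restriction of the projection, and let $Z_{n,q}\subset\mathbb{A}^3$ be the closed subscheme with defining ideal $(x^n,\;z^2+t^3+x\,q(x,z,t))$. (The morphism $\sigma_{n,q}$ is the affine modification of $\mathbb{A}^3$ with center $Z_{n,q}$ and divisor $\{x^n=0\}$.) All morphisms are morphisms of schemes over $\mathbb{C}$. Let $n_1,n_2\ge 2$ be integers and let $q_1,q_2\in\mathbb{C}[x,z,t]$. 1. For every isomorphism $\Phi:V_{n_1,q_1}\to V_{n_2,q_2}$ there exists an automorphism $\varphi$ of $\mathbb{A}^3$ which preserves the hyperplane $\{x=0\}$, maps $Z_{n_1,q_1}$ isomorphically onto $Z_{n_2,q_2}$, and satisfies $\sigma_{n_2,q_2}\circ\Phi=\varphi\circ\sigma_{n_1,q_1}$.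 2. Conversely, for every automorphism $\varphi$ of $\mathbb{A}^3$ which preserves the hyperplane $\{x=0\}$ and maps $Z_{n_1,q_1}$ isomorphically onto $Z_{n_2,q_2}$, there exists an isomorphism $\Phi:V_{n_1,q_1}\to V_{n_2,q_2}$ such that $\sigma_{n_2,q_2}\circ\Phi=\varphi\circ\sigma_{n_1,q_1}$. -/

import Mathlib

open AlgebraicGeometry CategoryTheory MvPolynomial

noncomputable section

namespace AffineThreefold

/-- Schemes over `Spec ℂ`; their morphisms are the morphisms of complex schemes. -/
abbrev CSch : Type 1 := Over (Spec (CommRingCat.of ℂ))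

/-- The spectrum of a `ℂ`-algebra, as a scheme over `Spec ℂ`. -/
abbrev specC (R : Type) [CommRing R] [Algebra ℂ R] : CSch :=
  (algSpec (CommRingCat.of ℂ)).obj (Opposite.op (CommAlgCat.of ℂ R))

/-- The morphism of spectra induced by a homomorphism of `ℂ`-algebras. -/
abbrev specCMap {R S : Type} [CommRing R] [Algebra ℂ R] [CommRing S] [Algebra ℂ S]
    (f : R →ₐ[ℂ] S) : specC S ⟶ specC R :=
  (algSpec (CommRingCat.of ℂ)).map (CommAlgCat.ofHom f).op

/-- The closed subscheme of `Spec R` with defining ideal `I`. -/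
abbrev closedSub {R : Type} [CommRing R] [Algebra ℂ R] (I : Ideal R) : CSch :=
  specC (R ⧸ I)

/-- The closed immersion of the subscheme with defining ideal `I` into `Spec R`. -/
abbrev closedSubι {R : Type} [CommRing R] [Algebra ℂ R] (I : Ideal R) :
    closedSub I ⟶ specC R :=
  specCMap (Ideal.Quotient.mkₐ ℂ I)

/-- The polynomial ring `ℂ[x, z, t]`, with `x = X 0`, `z = X 1`, `t = X 2`. -/
abbrev Pol3 : Type := MvPolynomial (Fin 3) ℂ

/-- The polynomial ring `ℂ[x, y, z, t]`, with `x = X 0`, `y = X 1`, `z = X 2`, `t = X 3`. -/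
abbrev Pol4 : Type := MvPolynomial (Fin 4) ℂ

/-- Affine space `𝔸³ = Spec ℂ[x, z, t]`. -/
abbrev A3 : CSch := specC Pol3

/-- Affine space `𝔸⁴ = Spec ℂ[x, y, z, t]`. -/
abbrev A4 : CSch := specC Pol4

/-- The inclusion `ℂ[x, z, t] → ℂ[x, y, z, t]`. -/
def incl : Pol3 →ₐ[ℂ] Pol4 := rename ![0, 2, 3]

/-- The projection `pr_{x,z,t} : 𝔸⁴ → 𝔸³`. -/
abbrev prXZT : A4 ⟶ A3 := specCMap incl

/-- The polynomial `xⁿ y + z² + t³ + x q(x, z, t)`. -/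
def equation (n : ℕ) (q : Pol3) : Pol4 :=
  X 0 ^ n * X 1 + X 2 ^ 2 + X 3 ^ 3 + X 0 * incl q

/-- The threefold `V_{n,q}` in `𝔸⁴` defined by `xⁿ y + z² + t³ + x q(x, z, t) = 0`. -/
abbrev V (n : ℕ) (q : Pol3) : CSch := closedSub (Ideal.span {equation n q})

/-- The closed embedding of `V_{n,q}` in `𝔸⁴`. -/
abbrev Vι (n : ℕ) (q : Pol3) : V n q ⟶ A4 := closedSubι (Ideal.span {equation n q})

/-- The modification morphism `σ_{n,q} : V_{n,q} → 𝔸³`, the restriction of `pr_{x,z,t}`. -/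
def modif (n : ℕ) (q : Pol3) : V n q ⟶ A3 := Vι n q ≫ prXZT

/-- The ideal `I_{n,q} = (xⁿ, z² + t³ + x q(x, z, t))` of `ℂ[x, z, t]`, which defines the center
`Z_{n,q}` of the modification. -/
def centerIdeal (n : ℕ) (q : Pol3) : Ideal Pol3 :=
  Ideal.span {X 0 ^ n, X 1 ^ 2 + X 2 ^ 3 + X 0 * q}

/-- The ideal `(x)` of `ℂ[x, z, t]`, which defines the hyperplane `{x = 0}`. -/
def hyperplaneIdeal : Ideal Pol3 := Ideal.span {X 0}

/-- The automorphism `φ` of `𝔸³` maps the closed subscheme with defining ideal `I` isomorphically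
onto the closed subscheme with defining ideal `J`: it restricts to an isomorphism between them. -/
def MapsIsoOnto (φ : A3 ≅ A3) (I J : Ideal Pol3) : Prop :=
  ∃ e : closedSub I ≅ closedSub J, e.hom ≫ closedSubι J = closedSubι I ≫ φ.hom

/-- The automorphism `φ` of `𝔸³` preserves the hyperplane `{x = 0}` and maps the center
`Z_{n₁,q₁}` isomorphically onto the center `Z_{n₂,q₂}`. -/
def PreservesLoci (φ : A3 ≅ A3) (n₁ : ℕ) (q₁ : Pol3) (n₂ : ℕ) (q₂ : Pol3) : Prop :=
  MapsIsoOnto φ hyperplaneIdeal hyperplaneIdeal ∧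
    MapsIsoOnto φ (centerIdeal n₁ q₁) (centerIdeal n₂ q₂)

/-- `Φ` is a lift of `φ` via the modification morphisms: `σ_{n₂,q₂} ∘ Φ = φ ∘ σ_{n₁,q₁}`. -/
def IsLift {n₁ n₂ : ℕ} {q₁ q₂ : Pol3} (Φ : V n₁ q₁ ≅ V n₂ q₂) (φ : A3 ≅ A3) : Prop :=
  Φ.hom ≫ modif n₂ q₂ = modif n₁ q₁ ≫ φ.hom

end AffineThreefold

end

/-! Both parts are dual to statements about the coordinate ring A of V, which contains ℂ[x, z, t]
and in which xⁿy = -f, where f = z² + t³ + xq. The heart is that the kernel of every nonzero locally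
nilpotent derivation of A lies in ℂ[x, z, t] (`exists_base_eq_of_apply_eq_zero`). Each of x, z, t is
killed by a triangular derivation xⁿ∂ᵢ - (∂ᵢf)∂_y, and isomorphisms transport locally nilpotent
derivations, so an isomorphism and its inverse both preserve ℂ[x, z, t]. The resulting automorphism
φ sends x to a unit multiple of x, the two exponents agree, and the center ideal, being xⁿA ∩ ℂ[x,
z, t], is preserved. Conversely, if φ respects (x) and the center ideals, then φ(f₁) is divisible by
xⁿ in A₂, and the quotient dictates the image of y.

For the kernel theorem, embed A in the Laurent ring in x, z, t with lexicographic weights (-1, 0),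
(0, 3), (0, 2). Then y has weight (n, 6) and leading form ŷ = -x⁻ⁿ(z² + t³), in which q has
disappeared. Every nonzero element of A has a leading form ŷᴶh with h a homogeneous polynomial,
where J = 0 only for elements of ℂ[x, z, t] (`exists_lead_coord`). A nonzero locally nilpotent D
induces a nonzero homogeneous derivation E on leading forms, and a kernel element outside ℂ[x, z, t]
forces Eŷ = 0.

Then xⁿŷ + z² + t³ = 0 with n ≥ 2, together with a degree argument of Mason–Stothers type, prevents
E from killing x, z, t or any z² + ct³, which are the prime factors of homogeneous polynomials. So
the last nonzero E-derivative of a homogeneous polynomial is a scalar times a power of ŷ, and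
weights determine how many derivatives it takes. For a suitable c the top terms of z² and ct³
cancel, although the weights forbid the drop in degree (`false_of_homogeneous`). -/

/-! ### Locally nilpotent derivations and exponential series -/

/-- The exponential series `∑ Dᵏ a / k! Tᵏ` of a derivation. -/
noncomputable def expSeries {K S : Type*} [Field K] [CommRing S] [Algebra K S]
    (D : Derivation K S S) (a : S) : PowerSeries S :=
  PowerSeries.mk fun k => ((k.factorial : K)⁻¹) • D^[k] a

namespace Derivation
variable {K S : Type*} [Field K] [CommRing S] [Algebra K S] (D : Derivation K S S)

theorem expSeries_add (a b : S) : expSeries D (a + b) = expSeries D a + expSeries D b := by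
  ext k
  simp [expSeries]

theorem expSeries_of_apply_eq_zero {a : S} (h : D a = 0) : expSeries D a = PowerSeries.C a := by
  ext k
  cases k with
  | zero => simp [expSeries]
  | succ k => simp [expSeries, h, iterate_map_zero]

theorem coeff_of_coe_eq_expSeries {D : Derivation K S S} {a : S} {p : Polynomial S}
    (hp : (p : PowerSeries S) = expSeries D a) (k : ℕ) :
    p.coeff k = ((k.factorial : K)⁻¹) • D^[k] a := by
  rw [← Polynomial.coeff_coe, hp, expSeries, PowerSeries.coeff_mk]

variable [CharZero K]

theorem coeff_expSeries_succ (a : S) (k : ℕ) :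
    ((k : S) + 1) * PowerSeries.coeff (k + 1) (expSeries D a) =
      PowerSeries.coeff k (expSeries D (D a)) := by
  have h : ((k : S) + 1) = algebraMap K S (k + 1) := by simp
  rw [h, ← Algebra.smul_def]
  simp only [expSeries, PowerSeries.coeff_mk, smul_smul, Function.iterate_succ_apply]
  congr 1
  have h1 : (k : K) + 1 ≠ 0 := by exact_mod_cast Nat.succ_ne_zero k
  rw [Nat.factorial_succ]
  push_cast
  field_simp

theorem derivative_expSeries (a : S) :
    PowerSeries.derivative S (expSeries D a) = expSeries D (D a) := by
  ext k
  rw [PowerSeries.coeff_derivative, mul_comm, coeff_expSeries_succ]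

/-- Differentiation in T turns the series of a into that of D a, so the Leibniz rule reduces the
coefficient of order k + 1 to order k; k + 1 is invertible in characteristic zero. -/
theorem expSeries_mul (a b : S) : expSeries D (a * b) = expSeries D a * expSeries D b := by
  ext k
  induction k generalizing a b with
  | zero => simp [expSeries]
  | succ k ih =>
    have h1 : ((k : K) + 1) ≠ 0 := by exact_mod_cast Nat.succ_ne_zero k
    have h2 : IsUnit ((k : S) + 1) := by
      have h : ((k : S) + 1) = algebraMap K S (k + 1) := by simp
      rw [h]
      exact (IsUnit.mk0 _ h1).map _
    refine h2.mul_left_cancel ?_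
    rw [coeff_expSeries_succ, D.leibniz, smul_eq_mul, smul_eq_mul, expSeries_add, map_add, ih, ih,
      mul_comm _ (PowerSeries.coeff (k + 1) _), ← PowerSeries.coeff_derivative, Derivation.leibniz,
      derivative_expSeries, derivative_expSeries, smul_eq_mul, smul_eq_mul, map_add]


/-- The subalgebra of elements on which `D` acts nilpotently. -/
def nilSubalgebra : Subalgebra K S where
  carrier := {a | ∃ p : Polynomial S, (p : PowerSeries S) = expSeries D a}
  add_mem' := by
    rintro a b ⟨p, hp⟩ ⟨r, hr⟩
    exact ⟨p + r, by rw [Polynomial.coe_add, hp, hr, expSeries_add]⟩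
  mul_mem' := by
    rintro a b ⟨p, hp⟩ ⟨r, hr⟩
    exact ⟨p * r, by rw [Polynomial.coe_mul, hp, hr, expSeries_mul]⟩
  algebraMap_mem' c := ⟨Polynomial.C (algebraMap K S c), by
    rw [Polynomial.coe_C, expSeries_of_apply_eq_zero D (D.map_algebraMap c)]⟩

variable {D}

theorem coeff_eq_zero_iff_iterate {a : S} {p : Polynomial S}
    (hp : (p : PowerSeries S) = expSeries D a) (k : ℕ) : p.coeff k = 0 ↔ D^[k] a = 0 := by
  rw [coeff_of_coe_eq_expSeries hp]
  have : (k.factorial : K)⁻¹ ≠ 0 := inv_ne_zero (by exact_mod_cast k.factorial_ne_zero)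
  exact smul_eq_zero_iff_right this

theorem mem_nilSubalgebra_iff {a : S} : a ∈ nilSubalgebra D ↔ ∃ k, D^[k] a = 0 := by
  constructor
  · rintro ⟨p, hp⟩
    refine ⟨p.natDegree + 1, ?_⟩
    rw [← coeff_eq_zero_iff_iterate hp]
    exact Polynomial.coeff_eq_zero_of_natDegree_lt (Nat.lt_succ_self _)
  · rintro ⟨k, hk⟩
    refine ⟨PowerSeries.trunc k (expSeries D a), ?_⟩
    ext m
    rw [Polynomial.coeff_coe, PowerSeries.coeff_trunc]
    split_ifs with h
    · rfl
    · obtain ⟨r, rfl⟩ := Nat.exists_eq_add_of_le (not_lt.1 h)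
      rw [expSeries, PowerSeries.coeff_mk, Nat.add_comm, Function.iterate_add_apply, hk,
        iterate_map_zero, smul_zero]

theorem apply_eq_zero_of_natDegree_eq_zero {a : S} {p : Polynomial S}
    (hp : (p : PowerSeries S) = expSeries D a) (h : p.natDegree = 0) : D a = 0 := by
  have := (coeff_eq_zero_iff_iterate hp 1).1
    (Polynomial.coeff_eq_zero_of_natDegree_lt (by omega))
  simpa using this

theorem coe_eq_expSeries_ne_zero {a : S} {p : Polynomial S}
    (hp : (p : PowerSeries S) = expSeries D a) (ha : a ≠ 0) : p ≠ 0 := by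
  rintro rfl
  have := (coeff_eq_zero_iff_iterate hp 0).1 (by simp)
  exact ha this

/-- The kernel is factorially closed. -/
theorem apply_eq_zero_of_mul [IsDomain S] {a b : S} (ha : a ∈ nilSubalgebra D)
    (hb : b ∈ nilSubalgebra D) (hab : a * b ≠ 0) (h : D (a * b) = 0) : D a = 0 := by
  obtain ⟨p, hp⟩ := ha
  obtain ⟨r, hr⟩ := hb
  -- The series of ab is constant, and degrees in T add over a domain, so both factors have degree
  -- zero.
  have h1 : p * r = Polynomial.C (a * b) := by
    apply Polynomial.coe_injective
    rw [Polynomial.coe_mul, hp, hr, ← expSeries_mul, expSeries_of_apply_eq_zero D h,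
      Polynomial.coe_C]
  refine apply_eq_zero_of_natDegree_eq_zero hp ?_
  have h2 := congrArg Polynomial.natDegree h1
  rw [Polynomial.natDegree_mul (coe_eq_expSeries_ne_zero hp (left_ne_zero_of_mul hab))
    (coe_eq_expSeries_ne_zero hr (right_ne_zero_of_mul hab)), Polynomial.natDegree_C] at h2
  omega

/-- The relation makes p and r coprime, and differentiating it yields pᵏ⁻¹ ∣ r' and rˡ⁻¹ ∣ p'. If
both derivatives were nonzero, k, l ≥ 2 would give deg p < deg r < deg p. -/
theorem _root_.Polynomial.derivative_eq_zero_of_pow_add_pow {F : Type*} [Field F] [CharZero F]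
    {p r : Polynomial F} {α β c : F} {k l : ℕ} (hk : 2 ≤ k) (hl : 2 ≤ l) (hα : α ≠ 0) (hβ : β ≠ 0)
    (hc : c ≠ 0)
    (h : Polynomial.C α * p ^ k + Polynomial.C β * r ^ l = Polynomial.C c) :
    Polynomial.derivative p = 0 := by
  have hcop : IsCoprime p r := by
    refine ⟨Polynomial.C (c⁻¹ * α) * p ^ (k - 1), Polynomial.C (c⁻¹ * β) * r ^ (l - 1), ?_⟩
    have e1 : p ^ k = p ^ (k - 1) * p := by rw [← pow_succ]; congr 1; omega
    have e2 : r ^ l = r ^ (l - 1) * r := by rw [← pow_succ]; congr 1; omega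
    have : Polynomial.C c⁻¹ * Polynomial.C c = 1 := by
      rw [← Polynomial.C_mul, inv_mul_cancel₀ hc, Polynomial.C_1]
    rw [← this, ← h, e1, e2, Polynomial.C_mul, Polynomial.C_mul]
    ring
  have hd : Polynomial.C (α * k) * (p ^ (k - 1) * Polynomial.derivative p) =
      - (Polynomial.C (β * l) * (r ^ (l - 1) * Polynomial.derivative r)) := by
    have := congrArg Polynomial.derivative h
    simp only [Polynomial.derivative_add, Polynomial.derivative_C_mul, Polynomial.derivative_pow,
      Polynomial.derivative_C] at this
    rw [eq_neg_iff_add_eq_zero, ← this]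
    simp only [Polynomial.C_mul]
    ring
  have hαk : IsUnit (Polynomial.C (α * k)) :=
    Polynomial.isUnit_C.2 (IsUnit.mk0 _ (mul_ne_zero hα (by norm_cast; omega)))
  have hβl : IsUnit (Polynomial.C (β * l)) :=
    Polynomial.isUnit_C.2 (IsUnit.mk0 _ (mul_ne_zero hβ (by norm_cast; omega)))
  have hp : p ^ (k - 1) ∣ Polynomial.derivative r := by
    have : p ^ (k - 1) ∣ Polynomial.C (β * l) * (r ^ (l - 1) * Polynomial.derivative r) := by
      rw [← dvd_neg, ← hd]
      exact (dvd_mul_right _ _).mul_left _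
    exact (hcop.pow (m := k - 1) (n := l - 1)).dvd_of_dvd_mul_left (hβl.dvd_mul_left.1 this)
  have hr : r ^ (l - 1) ∣ Polynomial.derivative p := by
    have : r ^ (l - 1) ∣ Polynomial.C (α * k) * (p ^ (k - 1) * Polynomial.derivative p) := by
      rw [hd, dvd_neg]
      exact (dvd_mul_right _ _).mul_left _
    exact (hcop.symm.pow (m := l - 1) (n := k - 1)).dvd_of_dvd_mul_left
      (hαk.dvd_mul_left.1 this)
  by_contra h0
  have hp0 : p ≠ 0 := by rintro rfl; simp at h0
  by_cases hr0 : Polynomial.derivative r = 0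
  · rw [hr0, mul_zero, mul_zero, neg_zero] at hd
    exact mul_ne_zero hαk.ne_zero (mul_ne_zero (pow_ne_zero _ hp0) h0) hd
  · have l1 := Polynomial.natDegree_le_of_dvd hp hr0
    have l2 := Polynomial.natDegree_le_of_dvd hr h0
    rw [Polynomial.natDegree_pow] at l1 l2
    have d1 : p.natDegree ≠ 0 := fun e => h0 (Polynomial.derivative_of_natDegree_zero e)
    have d2 : r.natDegree ≠ 0 := fun e => hr0 (Polynomial.derivative_of_natDegree_zero e)
    have l3 := Polynomial.natDegree_derivative_lt d1
    have l4 := Polynomial.natDegree_derivative_lt d2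
    have l5 : 1 * p.natDegree ≤ (k - 1) * p.natDegree := Nat.mul_le_mul_right _ (by omega)
    have l6 : 1 * r.natDegree ≤ (l - 1) * r.natDegree := Nat.mul_le_mul_right _ (by omega)
    omega

/-- The exponential series turns the relation into one between polynomials in T, in which α, β, c
stay constant because D kills them; the polynomial lemma applies over the fraction field. -/
theorem apply_eq_zero_of_pow_add_pow [IsDomain S] {a b α β c : S} {k l : ℕ} (hk : 2 ≤ k)
    (hl : 2 ≤ l) (hα : α ≠ 0) (hβ : β ≠ 0) (hc : c ≠ 0) (dα : D α = 0) (dβ : D β = 0)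
    (dc : D c = 0) (ha : a ∈ nilSubalgebra D) (hb : b ∈ nilSubalgebra D)
    (h : α * a ^ k + β * b ^ l = c) : D a = 0 := by
  obtain ⟨p, hp⟩ := ha
  obtain ⟨r, hr⟩ := hb
  have hpow : ∀ (u : S) (m : ℕ), expSeries D (u ^ m) = expSeries D u ^ m := by
    intro u m
    induction m with
    | zero => rw [pow_zero, pow_zero, expSeries_of_apply_eq_zero D (by simp), map_one]
    | succ m ih => rw [pow_succ, pow_succ, expSeries_mul, ih]
  have h1 : Polynomial.C α * p ^ k + Polynomial.C β * r ^ l = Polynomial.C c := by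
    apply Polynomial.coe_injective
    rw [Polynomial.coe_add, Polynomial.coe_mul, Polynomial.coe_mul, Polynomial.coe_pow,
      Polynomial.coe_pow, hp, hr, Polynomial.coe_C, Polynomial.coe_C, Polynomial.coe_C,
      ← expSeries_of_apply_eq_zero D dα, ← expSeries_of_apply_eq_zero D dβ,
      ← expSeries_of_apply_eq_zero D dc, ← h, expSeries_add, expSeries_mul, expSeries_mul,
      hpow, hpow]
  let ι := algebraMap S (FractionRing S)
  have hι : Function.Injective ι := IsFractionRing.injective S (FractionRing S)
  have : CharZero S := charZero_of_injective_algebraMap (algebraMap K S).injective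
  have h2 := congrArg (Polynomial.map ι) h1
  simp only [Polynomial.map_add, Polynomial.map_mul, Polynomial.map_pow, Polynomial.map_C] at h2
  have hne : ∀ {s : S}, s ≠ 0 → ι s ≠ 0 := fun hs => (map_ne_zero_iff ι hι).2 hs
  have h3 := Polynomial.derivative_eq_zero_of_pow_add_pow hk hl (hne hα) (hne hβ) (hne hc) h2
  refine apply_eq_zero_of_natDegree_eq_zero hp ?_
  rw [← Polynomial.natDegree_map_eq_of_injective hι]
  exact Polynomial.derivative_eq_zero.1 h3

end Derivation

/-! ### Laurent polynomials, weights and leading forms -/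

noncomputable section
namespace AffineThreefold

/-- Exponents of Laurent monomials in `x`, `z`, `t`. -/
abbrev Expo : Type := ℤ × ℤ × ℤ

/-- The Laurent polynomial ring `ℂ[x^±1, z^±1, t^±1]`. -/
abbrev Laurent : Type := AddMonoidAlgebra ℂ Expo

/-- The value group of the weight filtration. -/
abbrev Wt : Type := Lex (ℤ × ℤ)

/-- The weight of a Laurent monomial: `x` has weight `(-1, 0)`, `z` has weight `(0, 3)` and `t` has
weight `(0, 2)`. -/
def wt : Expo →+ Wt where
  toFun m := toLex (-m.1, 3 * m.2.1 + 2 * m.2.2)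
  map_zero' := rfl
  map_add' a b := by
    rw [← toLex_add]
    congr 1
    ext <;> simp <;> ring

/-- Laurent polynomials with support in `P`. -/
def supp (P : Set Expo) : Submodule ℂ Laurent where
  carrier := {s | ∀ m, s.coeff m ≠ 0 → m ∈ P}
  zero_mem' m h := by simp at h
  add_mem' {a b} ha hb m h := by
    by_cases h1 : a.coeff m = 0
    · exact hb m fun h2 => h (by simp [h1, h2])
    · exact ha m h1
  smul_mem' c a ha m h := ha m fun h2 => h (by simp [h2])

theorem mem_supp {P : Set Expo} {s : Laurent} : s ∈ supp P ↔ ∀ m, s.coeff m ≠ 0 → m ∈ P := Iff.rfl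

theorem supp_mono {P Q : Set Expo} (h : P ⊆ Q) : supp P ≤ supp Q := fun _ hs m hm => h (hs m hm)

theorem single_mem_supp {P : Set Expo} {m : Expo} (h : m ∈ P) (c : ℂ) :
    AddMonoidAlgebra.single m c ∈ supp P := by
  intro m' h'
  rw [AddMonoidAlgebra.coeff_single, Finsupp.single_apply] at h'
  split_ifs at h' with e
  · exact e ▸ h
  · exact absurd rfl h'

theorem mul_mem_supp {P Q R : Set Expo} (h : ∀ p ∈ P, ∀ q ∈ Q, p + q ∈ R) {a b : Laurent}
    (ha : a ∈ supp P) (hb : b ∈ supp Q) : a * b ∈ supp R := by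
  classical
  intro m hm
  have := AddMonoidAlgebra.support_coeff_mul_subset a b (Finsupp.mem_support_iff.2 hm)
  obtain ⟨p, hp, q, hq, rfl⟩ := Finset.mem_add.1 this
  exact h p (ha p (Finsupp.mem_support_iff.1 hp)) q (hb q (Finsupp.mem_support_iff.1 hq))

theorem eq_zero_of_mem_supp {P Q : Set Expo} (h : Disjoint P Q) {a : Laurent} (ha : a ∈ supp P)
    (hb : a ∈ supp Q) : a = 0 := by
  apply AddMonoidAlgebra.coeff_injective
  ext m
  by_contra hm
  exact Set.disjoint_left.1 h (ha m hm) (hb m hm)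

/-- Laurent polynomials which are homogeneous of weight `d`. -/
abbrev homog (d : Wt) : Submodule ℂ Laurent := supp {m | wt m = d}

/-- Laurent polynomials all of whose terms have weight less than `d`. -/
abbrev below (d : Wt) : Submodule ℂ Laurent := supp {m | wt m < d}

/-- The homogeneous part of weight `d` of `a` is `h`, and all other terms have lower weight. -/
def Lead (d : Wt) (a h : Laurent) : Prop := h ∈ homog d ∧ a - h ∈ below d

theorem homog_mul {d e : Wt} {a b : Laurent} (ha : a ∈ homog d) (hb : b ∈ homog e) :
    a * b ∈ homog (d + e) :=
  mul_mem_supp (fun p hp q hq => by simp_all [map_add]) ha hb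

theorem Lead.self {d : Wt} {a : Laurent} (ha : a ∈ homog d) : Lead d a a :=
  ⟨ha, by rw [sub_self]; exact zero_mem _⟩

theorem Lead.add {d : Wt} {a b h k : Laurent} (ha : Lead d a h) (hb : Lead d b k) :
    Lead d (a + b) (h + k) :=
  ⟨add_mem ha.1 hb.1, by rw [add_sub_add_comm]; exact add_mem ha.2 hb.2⟩

theorem Lead.mul {d e : Wt} {a b h k : Laurent} (ha : Lead d a h) (hb : Lead e b k) :
    Lead (d + e) (a * b) (h * k) := by
  refine ⟨homog_mul ha.1 hb.1, ?_⟩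
  have e1 : a * b - h * k = h * (b - k) + (a - h) * k + (a - h) * (b - k) := by ring
  rw [e1]
  refine add_mem (add_mem ?_ ?_) ?_
  · exact mul_mem_supp (fun p hp q hq => by
      rw [Set.mem_ofPred_eq] at *; rw [map_add, hp]; exact add_lt_add_right hq _) ha.1 hb.2
  · exact mul_mem_supp (fun p hp q hq => by
      rw [Set.mem_ofPred_eq] at *; rw [map_add, hq]; exact add_lt_add_left hp _) ha.2 hb.1
  · exact mul_mem_supp (fun p hp q hq => by
      rw [Set.mem_ofPred_eq] at *; rw [map_add]; exact add_lt_add hp hq) ha.2 hb.2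

theorem Lead.pow {d : Wt} {a h : Laurent} (ha : Lead d a h) (k : ℕ) :
    Lead (k • d) (a ^ k) (h ^ k) := by
  induction k with
  | zero =>
    rw [zero_smul, pow_zero, pow_zero]
    exact Lead.self (single_mem_supp (by simp) _)
  | succ k ih => rw [succ_nsmul, pow_succ, pow_succ]; exact ih.mul ha

theorem Lead.add_below {d : Wt} {a b h : Laurent} (ha : Lead d a h) (hb : b ∈ below d) :
    Lead d (a + b) h :=
  ⟨ha.1, by rw [add_sub_right_comm]; exact add_mem ha.2 hb⟩

theorem Lead.eq_zero {d : Wt} {h : Laurent} (ha : Lead d 0 h) : h = 0 := by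
  have h2 := ha.2
  rw [zero_sub, Submodule.neg_mem_iff] at h2
  exact eq_zero_of_mem_supp (Set.disjoint_left.2 fun m h1 h2 => by
    rw [Set.mem_ofPred_eq] at h1 h2
    exact h2.ne h1) ha.1 h2

theorem Lead.neg {d : Wt} {a h : Laurent} (ha : Lead d a h) : Lead d (-a) (-h) :=
  ⟨neg_mem ha.1, by rw [← neg_sub']; exact neg_mem ha.2⟩

theorem Lead.weight_le {d e : Wt} {a h k : Laurent} (ha : Lead d a h) (hb : Lead e a k)
    (hh : h ≠ 0) : d ≤ e := by
  by_contra! hlt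
  have : h = 0 := by
    have h1 : h = k + (a - k) - (a - h) := by ring
    refine eq_zero_of_mem_supp (P := {m | wt m = d}) (Q := {m | wt m < d})
      (Set.disjoint_left.2 fun m h1 h2 => ?_) ha.1 ?_
    · rw [Set.mem_ofPred_eq] at h1 h2
      exact h2.ne h1
    · rw [h1]
      refine sub_mem (add_mem ?_ ?_) ha.2
      · exact supp_mono (fun m hm => by rw [Set.mem_ofPred_eq] at *; rwa [hm]) hb.1
      · exact supp_mono (fun m hm => by rw [Set.mem_ofPred_eq] at *; exact hm.trans hlt) hb.2
  exact hh this

theorem Lead.unique {d : Wt} {a h k : Laurent} (ha : Lead d a h) (hb : Lead d a k) : h = k := by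
  have := (ha.add hb.neg)
  rw [add_neg_cancel] at this
  rw [← sub_eq_zero, sub_eq_add_neg]
  exact this.eq_zero

theorem Lead.unique_of_ne_zero {d e : Wt} {a h k : Laurent} (ha : Lead d a h) (hb : Lead e a k)
    (hh : h ≠ 0) (hk : k ≠ 0) : d = e ∧ h = k := by
  obtain rfl := le_antisymm (ha.weight_le hb hh) (hb.weight_le ha hk)
  exact ⟨rfl, ha.unique hb⟩

theorem exists_lead_of_le {d : Wt} {a : Laurent} (h : ∀ m, a.coeff m ≠ 0 → wt m ≤ d) :
    ∃ u, Lead d a u ∧ ∀ m, wt m = d → u.coeff m = a.coeff m := by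
  classical
  refine ⟨.ofCoeff (a.coeff.filter fun m => wt m = d), ⟨?_, ?_⟩, ?_⟩
  · intro m hm
    by_contra h2
    exact hm (Finsupp.filter_apply_neg _ _ h2)
  · intro m hm
    by_cases h2 : wt m = d
    · rw [AddMonoidAlgebra.coeff_sub, Finsupp.sub_apply, AddMonoidAlgebra.coeff_ofCoeff,
        Finsupp.filter_apply_pos (fun m => wt m = d) _ h2, sub_self] at hm
      exact absurd rfl hm
    · rw [AddMonoidAlgebra.coeff_sub, Finsupp.sub_apply, AddMonoidAlgebra.coeff_ofCoeff,
        Finsupp.filter_apply_neg (fun m => wt m = d) _ h2, sub_zero] at hm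
      exact lt_of_le_of_ne (h m hm) h2
  · intro m hm
    exact Finsupp.filter_apply_pos _ _ hm

theorem exists_lead {a : Laurent} (ha : a ≠ 0) : ∃ d u, u ≠ 0 ∧ Lead d a u := by
  have hne : a.coeff.support.Nonempty := by
    rw [Finsupp.support_nonempty_iff]
    exact fun h => ha (AddMonoidAlgebra.coeff_eq_zero.1 h)
  obtain ⟨m, hm, hmax⟩ := a.coeff.support.exists_max_image wt hne
  obtain ⟨u, hu, hc⟩ := exists_lead_of_le (d := wt m) (a := a)
    fun m' h' => hmax m' (Finsupp.mem_support_iff.2 h')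
  refine ⟨wt m, u, ?_, hu⟩
  rintro rfl
  exact Finsupp.mem_support_iff.1 hm (hc m rfl).symm

/-- The Euler operator of the Laurent polynomial ring with weights `χ`, as a linear map. -/
def eulerLinear (χ : Expo →+ ℤ) : Laurent →ₗ[ℂ] Laurent where
  toFun s := .ofCoeff (Finsupp.onFinset s.coeff.support (fun m => (χ m : ℂ) * s.coeff m)
    fun _ h => Finsupp.mem_support_iff.2 (right_ne_zero_of_mul h))
  map_add' a b := by
    apply AddMonoidAlgebra.coeff_injective
    ext m
    simp [mul_add]
  map_smul' c a := by
    apply AddMonoidAlgebra.coeff_injective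
    ext m
    simp [mul_left_comm]

theorem eulerLinear_single (χ : Expo →+ ℤ) (m : Expo) (c : ℂ) :
    eulerLinear χ (AddMonoidAlgebra.single m c) = AddMonoidAlgebra.single m (χ m * c) := by
  apply AddMonoidAlgebra.coeff_injective
  ext m'
  by_cases h : m = m'
  · subst h; simp [eulerLinear]
  · simp [eulerLinear, h]

/-- The Euler derivation of the Laurent polynomial ring with weights `χ`. -/
def euler (χ : Expo →+ ℤ) : Derivation ℂ Laurent Laurent :=
  Derivation.mk' (eulerLinear χ) (by
    intro a b
    induction a using AddMonoidAlgebra.induction_linear with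
    | zero => simp
    | add f g hf hg =>
      rw [add_mul, map_add, hf, hg, map_add]
      simp only [smul_eq_mul]; ring
    | single m c =>
      induction b using AddMonoidAlgebra.induction_linear with
      | zero => simp
      | add f g hf hg =>
        rw [mul_add, map_add, hf, hg, map_add]
        simp only [smul_eq_mul]; ring
      | single m' c' =>
        simp only [AddMonoidAlgebra.single_mul_single, eulerLinear_single, smul_eq_mul]
        rw [add_comm m' m, ← AddMonoidAlgebra.single_add]
        congr 1
        rw [map_add]
        push_cast
        ring)

theorem euler_single (χ : Expo →+ ℤ) (m : Expo) (c : ℂ) :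
    euler χ (AddMonoidAlgebra.single m c) = AddMonoidAlgebra.single m (χ m * c) :=
  eulerLinear_single χ m c

theorem euler_mem_supp (χ : Expo →+ ℤ) {P : Set Expo} {s : Laurent} (h : s ∈ supp P) :
    euler χ s ∈ supp P := fun m hm => h m (right_ne_zero_of_mul hm)

theorem Lead.euler {d : Wt} {a h : Laurent} (ha : Lead d a h) (χ : Expo →+ ℤ) :
    Lead d (euler χ a) (AffineThreefold.euler χ h) :=
  ⟨euler_mem_supp χ ha.1, by rw [← map_sub]; exact euler_mem_supp χ ha.2⟩

/-- The derivation of the Laurent polynomial ring with given logarithmic derivatives of `x`, `z`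
and `t`. -/
def logDer (u : Fin 3 → Laurent) : Derivation ℂ Laurent Laurent :=
  u 0 • euler (AddMonoidHom.fst ℤ (ℤ × ℤ)) +
  u 1 • euler ((AddMonoidHom.fst ℤ ℤ).comp (AddMonoidHom.snd ℤ (ℤ × ℤ))) +
  u 2 • euler ((AddMonoidHom.snd ℤ ℤ).comp (AddMonoidHom.snd ℤ (ℤ × ℤ)))

theorem Lead.logDer {δ d : Wt} {θ u : Fin 3 → Laurent} (hθ : ∀ i, Lead δ (θ i) (u i))
    {a h : Laurent} (ha : Lead d a h) :
    Lead (d + δ) (logDer θ a) (AffineThreefold.logDer u h) := by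
  rw [add_comm]
  exact (((hθ 0).mul (ha.euler _)).add ((hθ 1).mul (ha.euler _))).add ((hθ 2).mul (ha.euler _))

theorem Lead.logDer_iterate {δ d : Wt} {θ u : Fin 3 → Laurent} (hθ : ∀ i, Lead δ (θ i) (u i))
    {a h : Laurent} (ha : Lead d a h) (k : ℕ) :
    Lead (d + k • δ) ((AffineThreefold.logDer θ)^[k] a) ((AffineThreefold.logDer u)^[k] h) := by
  induction k with
  | zero => simpa using ha
  | succ k ih =>
    rw [Function.iterate_succ_apply', Function.iterate_succ_apply', succ_nsmul, ← add_assoc]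
    exact ih.logDer hθ

/-- The Laurent monomial `x`. -/
def lx : Laurent := AddMonoidAlgebra.single (1, 0, 0) 1
/-- The Laurent monomial `z`. -/
def lz : Laurent := AddMonoidAlgebra.single (0, 1, 0) 1
/-- The Laurent monomial `t`. -/
def lt : Laurent := AddMonoidAlgebra.single (0, 0, 1) 1

theorem logDer_lx (u : Fin 3 → Laurent) : logDer u lx = u 0 * lx := by
  simp [logDer, lx, euler_single]

theorem logDer_lz (u : Fin 3 → Laurent) : logDer u lz = u 1 * lz := by
  simp [logDer, lz, euler_single]

theorem logDer_lt (u : Fin 3 → Laurent) : logDer u lt = u 2 * lt := by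
  simp [logDer, lt, euler_single]

/-- All three components are truncated at one common weight, the largest that occurs in any of them.
Some truncations may vanish, but not all, so the leading derivation is homogeneous and nonzero. -/
theorem exists_logDer_lead {θ : Fin 3 → Laurent} (h : θ ≠ 0) :
    ∃ (δ : Wt) (u : Fin 3 → Laurent), u ≠ 0 ∧ ∀ i, Lead δ (θ i) (u i) := by
  classical
  let T : Finset Expo := Finset.univ.biUnion fun i => (θ i).coeff.support
  have hT : T.Nonempty := by
    obtain ⟨i, hi⟩ := Function.ne_iff.1 h
    have : (θ i).coeff.support.Nonempty := by
      rw [Finsupp.support_nonempty_iff]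
      exact fun h => hi (AddMonoidAlgebra.coeff_eq_zero.1 h)
    obtain ⟨m, hm⟩ := this
    exact ⟨m, Finset.mem_biUnion.2 ⟨i, Finset.mem_univ _, hm⟩⟩
  obtain ⟨m, hm, hmax⟩ := T.exists_max_image wt hT
  choose u hu hc using fun i => exists_lead_of_le (d := wt m) (a := θ i)
    fun m' h' => hmax m' (Finset.mem_biUnion.2 ⟨i, Finset.mem_univ _, Finsupp.mem_support_iff.2 h'⟩)
  refine ⟨wt m, u, ?_, hu⟩
  rintro rfl
  obtain ⟨i, -, hi⟩ := Finset.mem_biUnion.1 hm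
  exact Finsupp.mem_support_iff.1 hi (hc i m rfl).symm

end AffineThreefold
end

/-! ### Homogeneous polynomials and their prime factors -/

noncomputable section
namespace AffineThreefold

theorem wt_mk (i j k : ℤ) : wt (i, j, k) = toLex (-i, 3 * j + 2 * k) := rfl

theorem Lead.mem_supp {d : Wt} {a h : Laurent} (ha : Lead d a h) {P : Set Expo} (hP : a ∈ supp P) :
    h ∈ supp P := by
  intro m hm
  refine hP m fun h0 => ?_
  have h1 : wt m < d := ha.2 m (by simpa [h0] using hm)
  exact h1.ne (ha.1 m hm)

theorem Lead.wt_le {d : Wt} {a h : Laurent} (ha : Lead d a h) {m : Expo} (hm : a.coeff m ≠ 0) :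
    wt m ≤ d := by
  by_cases h0 : h.coeff m = 0
  · exact (ha.2 m (by simpa [h0] using hm)).le
  · exact (ha.1 m h0).le

/-- The exponent in `ℤ³` of a monomial of `ℂ[x, z, t]`. -/
def expo (m : Fin 3 →₀ ℕ) : Expo := (m 0, m 1, m 2)

theorem expo_injective : Function.Injective expo := by
  intro m m' h
  simp only [expo, Prod.mk.injEq, Nat.cast_inj] at h
  ext i
  fin_cases i
  · exact h.1
  · exact h.2.1
  · exact h.2.2

/-- The inclusion of `ℂ[x, z, t]` into the Laurent polynomial ring. -/
def toLaurent : Pol3 →ₐ[ℂ] Laurent := aeval ![lx, lz, lt]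

theorem algebraMap_laurent (c : ℂ) : algebraMap ℂ Laurent c = AddMonoidAlgebra.single 0 c := rfl

theorem lx_pow (k : ℕ) : lx ^ k = AddMonoidAlgebra.single ((k : ℤ), 0, 0) 1 := by
  simp [lx, AddMonoidAlgebra.single_pow]

theorem lz_pow (k : ℕ) : lz ^ k = AddMonoidAlgebra.single (0, (k : ℤ), 0) 1 := by
  simp [lz, AddMonoidAlgebra.single_pow]

theorem lt_pow (k : ℕ) : lt ^ k = AddMonoidAlgebra.single (0, 0, (k : ℤ)) 1 := by
  simp [lt, AddMonoidAlgebra.single_pow]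

theorem toLaurent_monomial (m : Fin 3 →₀ ℕ) (c : ℂ) :
    toLaurent (monomial m c) = AddMonoidAlgebra.single (expo m) c := by
  rw [toLaurent, aeval_monomial, Finsupp.prod_fintype _ _ (by simp), Fin.prod_univ_three,
    algebraMap_laurent]
  simp [lx_pow, lz_pow, lt_pow, AddMonoidAlgebra.single_mul_single, expo]

theorem toLaurent_X0 : toLaurent (X 0) = lx := by simp [toLaurent]
theorem toLaurent_X1 : toLaurent (X 1) = lz := by simp [toLaurent]
theorem toLaurent_X2 : toLaurent (X 2) = lt := by simp [toLaurent]

theorem coeff_toLaurent (p : Pol3) (m : Fin 3 →₀ ℕ) :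
    (toLaurent p).coeff (expo m) = p.coeff m := by
  classical
  induction p using MvPolynomial.induction_on' with
  | monomial u a =>
    rw [toLaurent_monomial, AddMonoidAlgebra.coeff_single, Finsupp.single_apply, coeff_monomial]
    simp only [expo_injective.eq_iff]
  | add p q hp hq => simp [hp, hq]

theorem toLaurent_injective : Function.Injective toLaurent := by
  intro p q h
  ext m
  rw [← coeff_toLaurent, h, coeff_toLaurent]

/-- Exponents of monomials which are not divisible by negative powers of the variables. -/
def nonneg : Set Expo := {m | 0 ≤ m.1 ∧ 0 ≤ m.2.1 ∧ 0 ≤ m.2.2}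

theorem toLaurent_mem_supp (p : Pol3) : toLaurent p ∈ supp nonneg := by
  induction p using MvPolynomial.induction_on' with
  | monomial u a =>
    rw [toLaurent_monomial]
    exact single_mem_supp (by simp [nonneg, expo]) _
  | add p q hp hq => rw [map_add]; exact add_mem hp hq

theorem exists_toLaurent_eq {h : Laurent} (hh : h ∈ supp nonneg) : ∃ p, toLaurent p = h := by
  rw [← AddMonoidAlgebra.sum_coeff_single h, Finsupp.sum]
  have : ∀ m ∈ h.coeff.support,
      AddMonoidAlgebra.single m (h.coeff m) ∈ toLaurent.range := by
    rintro ⟨i, j, k⟩ hm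
    obtain ⟨h1, h2, h3⟩ := hh _ (Finsupp.mem_support_iff.1 hm)
    lift i to ℕ using h1
    lift j to ℕ using h2
    lift k to ℕ using h3
    refine ⟨monomial (Finsupp.equivFunOnFinite.symm ![i, j, k]) (h.coeff (i, j, k)), ?_⟩
    exact toLaurent_monomial _ _
  exact sum_mem this

theorem supp_eq_sum {ι : Type*} (s : Finset ι) (f : ι → Expo) (hf : Set.InjOn f s) {h : Laurent}
    (hh : h ∈ supp (f '' s)) : h = ∑ i ∈ s, AddMonoidAlgebra.single (f i) (h.coeff (f i)) := by
  classical
  rw [← Finset.sum_image (f := fun m => AddMonoidAlgebra.single m (h.coeff m)) (g := f) hf]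
  conv_lhs => rw [← AddMonoidAlgebra.sum_coeff_single h]
  refine Finset.sum_subset ?_ ?_
  · intro m hm
    obtain ⟨i, hi, rfl⟩ := hh m (Finsupp.mem_support_iff.1 hm)
    exact Finset.mem_image_of_mem _ hi
  · intro m _ hm
    rw [Finsupp.notMem_support_iff.1 hm, AddMonoidAlgebra.single_zero]

/-- The prime homogeneous polynomials. -/
inductive IsPrimeForm : Laurent → Prop
  | x : IsPrimeForm lx
  | t : IsPrimeForm lt
  | z : IsPrimeForm lz
  | zt (c : ℂ) : IsPrimeForm (lz ^ 2 + algebraMap ℂ Laurent c * lt ^ 3)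

theorem exists_mul_single {h : Laurent} {P Q : Set Expo} (hh : h ∈ supp P) (m : Expo)
    (hPQ : ∀ p ∈ P, p - m ∈ Q) :
    ∃ h' ∈ supp Q, h = AddMonoidAlgebra.single m 1 * h' := by
  refine ⟨AddMonoidAlgebra.single (-m) 1 * h, ?_, ?_⟩
  · exact mul_mem_supp (P := {-m}) (fun p hp q hq => by
      rw [Set.mem_singleton_iff.1 hp, neg_add_eq_sub]; exact hPQ q hq) (single_mem_supp (Set.mem_singleton _) _) hh
  · rw [← mul_assoc, AddMonoidAlgebra.single_mul_single]
    simp [← AddMonoidAlgebra.one_def]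

/-- If neither x nor z divides h, some monomial is free of x and some is free of z. Equality of
weights then makes every monomial of the form z²ˢtᵏ⁻³ˢ, so h = tᵏp(z²/t³). Either p is constant, or
a root ρ of p splits off z² - ρt³. -/
theorem exists_isPrimeForm_mul {d : Wt} {h : Laurent} (hd : h ∈ homog d) (hn : h ∈ supp nonneg)
    (h0 : h ≠ 0) : (∃ c : ℂ, c ≠ 0 ∧ h = algebraMap ℂ Laurent c) ∨
      ∃ r, IsPrimeForm r ∧ ∃ h' ∈ supp nonneg, h = r * h' := by
  have key : h ∈ supp {m | m ∈ nonneg ∧ wt m = d} := fun m hm => ⟨hn m hm, hd m hm⟩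
  by_cases hx : h ∈ supp {m | 1 ≤ m.1 ∧ m ∈ nonneg}
  · refine Or.inr ⟨lx, .x, exists_mul_single hx _ ?_⟩
    rintro ⟨i, j, k⟩ ⟨h1, h2, h3, h4⟩
    simp only at h1 h3 h4
    simp [nonneg, h1, h3, h4]
  by_cases hz : h ∈ supp {m | 1 ≤ m.2.1 ∧ m ∈ nonneg}
  · refine Or.inr ⟨lz, .z, exists_mul_single hz _ ?_⟩
    rintro ⟨i, j, k⟩ ⟨h1, h2, h3, h4⟩
    simp only at h1 h2 h4
    simp [nonneg, h1, h2, h4]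
  rw [mem_supp] at hx hz
  push Not at hx hz
  obtain ⟨⟨i, j, k⟩, hm, hi⟩ := hx
  obtain ⟨⟨i', j', k'⟩, hm', hj'⟩ := hz
  obtain ⟨⟨a1, a2, a3⟩, a4⟩ := key _ hm
  obtain ⟨⟨b1, b2, b3⟩, b4⟩ := key _ hm'
  have hi : i = 0 := by
    by_contra hne
    exact hi ⟨by simp only at *; omega, a1, a2, a3⟩
  have hj' : j' = 0 := by
    by_contra hne
    exact hj' ⟨by simp only at *; omega, b1, b2, b3⟩
  subst hi hj'
  have e := a4.trans b4.symm
  rw [wt_mk, wt_mk, toLex_inj, Prod.mk.injEq] at e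
  have hi' : i' = 0 := by simpa using e.1.symm
  subst hi'
  simp only at b3
  lift k' to ℕ using b3
  have hk : ∀ m : Expo, m ∈ nonneg → wt m = d →
      m ∈ (fun s : ℕ => ((0 : ℤ), 2 * (s : ℤ), (k' : ℤ) - 3 * s)) ''
        (Finset.range (k' / 3 + 1) : Set ℕ) := by
    rintro ⟨i, j, k⟩ ⟨c1, c2, c3⟩ c4
    simp only at c1 c2 c3
    have e := c4.trans b4.symm
    rw [wt_mk, wt_mk, toLex_inj, Prod.mk.injEq] at e
    refine ⟨(j / 2).toNat, ?_, ?_⟩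
    · simp only [Finset.coe_range, Set.mem_Iio]; omega
    · simp only [Prod.mk.injEq]; omega
  have hsum := supp_eq_sum (Finset.range (k' / 3 + 1))
    (fun s : ℕ => ((0 : ℤ), 2 * (s : ℤ), (k' : ℤ) - 3 * s))
    (fun s _ s' _ e => by simp only [Prod.mk.injEq] at e; omega) (h := h)
    (fun m hm => hk m (hn m hm) (hd m hm))
  let p : Polynomial ℂ := ∑ s ∈ Finset.range (k' / 3 + 1),
    Polynomial.monomial s (h.coeff ((0 : ℤ), 2 * (s : ℤ), (k' : ℤ) - 3 * s))
  let κ : Laurent := AddMonoidAlgebra.single (0, 2, -3) 1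
  have hp : h = lt ^ k' * Polynomial.aeval κ p := by
    rw [map_sum, Finset.mul_sum]
    conv_lhs => rw [hsum]
    refine Finset.sum_congr rfl fun s _ => ?_
    rw [Polynomial.aeval_monomial, algebraMap_laurent, lt_pow, AddMonoidAlgebra.single_pow,
      AddMonoidAlgebra.single_mul_single, AddMonoidAlgebra.single_mul_single]
    congr 1
    · simp only [nsmul_eq_mul, Prod.mk_add_mk, Prod.smul_mk, Prod.mk.injEq, zero_add]
      refine ⟨?_, ?_, ?_⟩ <;> ring
    · simp
  have hpdeg : p.natDegree ≤ k' / 3 := by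
    refine Polynomial.natDegree_sum_le_of_forall_le _ _ fun s hs => ?_
    refine (Polynomial.natDegree_monomial_le _).trans ?_
    have := Finset.mem_range.1 hs
    omega
  by_cases hp0 : p.natDegree = 0
  · rw [Polynomial.eq_C_of_natDegree_eq_zero hp0, Polynomial.aeval_C] at hp
    rcases Nat.eq_zero_or_pos k' with rfl | hpos
    · left
      rw [pow_zero, one_mul] at hp
      refine ⟨p.coeff 0, fun hc => h0 ?_, hp⟩
      rw [hp, hc, map_zero]
    · right
      obtain ⟨r, rfl⟩ := Nat.exists_eq_add_of_lt hpos
      refine ⟨lt, .t, lt ^ r * algebraMap ℂ Laurent (p.coeff 0), ?_, ?_⟩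
      · rw [lt_pow, algebraMap_laurent, AddMonoidAlgebra.single_mul_single]
        exact single_mem_supp (by simp [nonneg]) _
      · rw [hp]; ring
  · right
    have hdeg : p.degree ≠ 0 := fun e => hp0 (Polynomial.natDegree_eq_of_degree_eq_some e)
    obtain ⟨ρ, hρ⟩ := IsAlgClosed.exists_root p hdeg
    obtain ⟨p1, rfl'⟩ := Polynomial.dvd_iff_isRoot.2 hρ
    have hp1 : p1.natDegree + 1 ≤ k' / 3 := by
      have : p1 ≠ 0 := by
        intro e
        rw [rfl', e] at hp0
        simp at hp0
      rw [rfl', Polynomial.natDegree_mul (Polynomial.X_sub_C_ne_zero ρ) this,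
        Polynomial.natDegree_X_sub_C] at hpdeg
      omega
    -- A nonconstant p has degree at most k'/3, so t³ is available to clear the denominator of the
    -- linear factor in z²/t³.
    obtain ⟨r, rfl⟩ : ∃ r, k' = 3 + r := ⟨k' - 3, by omega⟩
    refine ⟨_, .zt (-ρ), lt ^ r * Polynomial.aeval κ p1, ?_, ?_⟩
    · rw [Polynomial.aeval_eq_sum_range, Finset.mul_sum]
      refine sum_mem fun s hs => ?_
      rw [mul_smul_comm, lt_pow, AddMonoidAlgebra.single_pow, AddMonoidAlgebra.single_mul_single]
      refine Submodule.smul_mem _ _ (single_mem_supp ?_ _)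
      have := Finset.mem_range.1 hs
      simp only [nonneg, Set.mem_ofPred_eq, nsmul_eq_mul, Prod.mk_add_mk, Prod.smul_mk, zero_add]
      refine ⟨?_, ?_, ?_⟩ <;> omega
    · have hκ : lt ^ 3 * κ = lz ^ 2 := by
        rw [lt_pow, lz_pow, AddMonoidAlgebra.single_mul_single]
        norm_num
      rw [hp, rfl', map_mul, map_sub, Polynomial.aeval_X, Polynomial.aeval_C, map_neg, ← hκ]
      ring

end AffineThreefold
end

/-! ### The coordinate ring inside the Laurent ring -/

noncomputable section
namespace AffineThreefold

/-- The coordinate ring of `V_{n,q}`. -/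
abbrev Coord (n : ℕ) (q : Pol3) : Type := Pol4 ⧸ Ideal.span {equation n q}

/-- The quotient map to the coordinate ring. -/
abbrev Coord.mk (n : ℕ) (q : Pol3) : Pol4 →ₐ[ℂ] Coord n q :=
  Ideal.Quotient.mkₐ ℂ (Ideal.span {equation n q})

/-- The homomorphism of coordinate rings dual to the modification morphism. -/
def base (n : ℕ) (q : Pol3) : Pol3 →ₐ[ℂ] Coord n q := (Coord.mk n q).comp incl

/-- The polynomial `z² + t³ + x q`. -/
def centerPol (q : Pol3) : Pol3 := X 1 ^ 2 + X 2 ^ 3 + X 0 * q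

/-- The coordinate function `y`. -/
def Coord.y (n : ℕ) (q : Pol3) : Coord n q := Coord.mk n q (X 1)

variable {n : ℕ} {q : Pol3}

theorem incl_X0 : incl (X 0) = X 0 := by simp [incl]
theorem incl_X1 : incl (X 1) = X 2 := by simp [incl]
theorem incl_X2 : incl (X 2) = X 3 := by simp [incl]

theorem equation_eq : equation n q = X 0 ^ n * X 1 + incl (centerPol q) := by
  simp only [equation, centerPol, map_add, map_mul, map_pow, incl_X0, incl_X1, incl_X2]
  ring

theorem Coord.relation : base n q (X 0) ^ n * Coord.y n q = - base n q (centerPol q) := by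
  rw [eq_neg_iff_add_eq_zero, base, AlgHom.comp_apply, AlgHom.comp_apply, incl_X0, Coord.y,
    ← map_pow, ← map_mul, ← map_add, ← equation_eq]
  exact Ideal.Quotient.eq_zero_iff_mem.2 (Ideal.subset_span rfl)

/-- Evaluation of polynomials in `y`. -/
def evalY (n : ℕ) (q : Pol3) : Polynomial Pol3 →+* Coord n q :=
  Polynomial.eval₂RingHom (base n q : Pol3 →+* Coord n q) (Coord.y n q)

theorem evalY_C (b : Pol3) : evalY n q (Polynomial.C b) = base n q b := by simp [evalY]
theorem evalY_X : evalY n q Polynomial.X = Coord.y n q := by simp [evalY]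

theorem evalY_surjective : Function.Surjective (evalY n q) := by
  intro a
  obtain ⟨p, rfl⟩ := Ideal.Quotient.mk_surjective a
  change Coord.mk n q p ∈ (evalY n q).range
  induction p using MvPolynomial.induction_on with
  | C c => exact ⟨Polynomial.C (C c), by rw [evalY_C, base, AlgHom.comp_apply, incl, rename_C]⟩
  | add p r hp hr => rw [map_add]; exact add_mem hp hr
  | mul_X p i hp =>
    rw [map_mul]
    refine mul_mem hp ?_
    fin_cases i
    · exact ⟨Polynomial.C (X 0), by rw [evalY_C, base, AlgHom.comp_apply, incl_X0]; rfl⟩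
    · exact ⟨Polynomial.X, evalY_X⟩
    · exact ⟨Polynomial.C (X 1), by rw [evalY_C, base, AlgHom.comp_apply, incl_X1]; rfl⟩
    · exact ⟨Polynomial.C (X 2), by rw [evalY_C, base, AlgHom.comp_apply, incl_X2]; rfl⟩

/-- The Laurent monomial `x⁻ⁿ`. -/
def lxInv (n : ℕ) : Laurent := AddMonoidAlgebra.single (-(n : ℤ), 0, 0) 1

theorem lx_pow_mul_lxInv (n : ℕ) : lx ^ n * lxInv n = 1 := by
  rw [lx_pow, lxInv, AddMonoidAlgebra.single_mul_single]
  simp only [Prod.mk_add_mk, add_neg_cancel, add_zero, mul_one]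
  rfl

/-- The embedding of the coordinate ring of `V_{n,q}` into the Laurent polynomial ring. -/
def Coord.toLaurent (n : ℕ) (q : Pol3) : Coord n q →ₐ[ℂ] Laurent :=
  Ideal.Quotient.liftₐ _
    (aeval ![lx, -(lxInv n * AffineThreefold.toLaurent (centerPol q)), lz, lt]) (by
      have h : (aeval ![lx, -(lxInv n * AffineThreefold.toLaurent (centerPol q)), lz, lt] :
          Pol4 →ₐ[ℂ] Laurent).comp incl = AffineThreefold.toLaurent := by
        ext i
        fin_cases i <;> simp [incl, AffineThreefold.toLaurent]
      intro a ha
      obtain ⟨r, rfl⟩ := Ideal.mem_span_singleton.1 ha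
      rw [map_mul, equation_eq, map_add, ← AlgHom.comp_apply, h]
      simp only [map_mul, map_pow, aeval_X]
      simp only [Matrix.cons_val_zero, Matrix.cons_val_one]
      rw [mul_neg, ← mul_assoc, lx_pow_mul_lxInv]
      ring)

theorem Coord.toLaurent_mk (p : Pol4) : Coord.toLaurent n q (Coord.mk n q p) =
    aeval ![lx, -(lxInv n * AffineThreefold.toLaurent (centerPol q)), lz, lt] p := rfl

theorem toLaurent_base (b : Pol3) :
    Coord.toLaurent n q (base n q b) = toLaurent b := by
  rw [← AlgHom.comp_apply]
  congr 1
  refine algHom_ext fun i => ?_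
  rw [AlgHom.comp_apply, base, AlgHom.comp_apply, Coord.toLaurent_mk]
  fin_cases i <;> simp [incl, AffineThreefold.toLaurent]

theorem toLaurent_y : Coord.toLaurent n q (Coord.y n q) = -(lxInv n * toLaurent (centerPol q)) := by
  rw [Coord.y, Coord.toLaurent_mk]
  simp

/-- The leading form of `y`. -/
def ly (n : ℕ) : Laurent := -(lxInv n * (lz ^ 2 + lt ^ 3))

/-- The weight of `y`. -/
def wy (n : ℕ) : Wt := toLex ((n : ℤ), 6)

theorem lx_mem : lx ∈ homog (toLex (-1, 0)) := single_mem_supp (by simp [wt_mk]) _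
theorem lz_mem : lz ∈ homog (toLex (0, 3)) := single_mem_supp (by simp [wt_mk]) _
theorem lt_mem : lt ∈ homog (toLex (0, 2)) := single_mem_supp (by simp [wt_mk]) _

theorem lz_sq_mem : lz ^ 2 ∈ homog (toLex (0, 6)) := by
  rw [lz_pow]; exact single_mem_supp (by simp [wt_mk]) _

theorem lt_cube_mem : lt ^ 3 ∈ homog (toLex (0, 6)) := by
  rw [lt_pow]; exact single_mem_supp (by simp [wt_mk]) _

theorem lxInv_mem (n : ℕ) : lxInv n ∈ homog (toLex ((n : ℤ), 0)) :=
  single_mem_supp (by simp [wt_mk]) _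

/-- The factor x makes the first weight component of every term of xq negative, so q does not
contribute. -/
theorem lead_centerPol (q : Pol3) :
    Lead (toLex (0, 6)) (toLaurent (centerPol q)) (lz ^ 2 + lt ^ 3) := by
  rw [centerPol, map_add, map_add, map_pow, map_pow, map_mul, toLaurent_X0, toLaurent_X1,
    toLaurent_X2]
  refine (Lead.self (add_mem lz_sq_mem lt_cube_mem)).add_below ?_
  refine mul_mem_supp (P := {(1, 0, 0)}) ?_ (single_mem_supp (Set.mem_singleton _) _) (toLaurent_mem_supp q)
  rintro p hp ⟨i, j, k⟩ ⟨h1, h2, h3⟩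
  rw [Set.mem_singleton_iff.1 hp, Set.mem_ofPred_eq, Prod.mk_add_mk, Prod.mk_add_mk, wt_mk]
  refine Prod.Lex.toLex_lt_toLex.2 (Or.inl ?_)
  simp only at *
  omega

theorem lead_y : Lead (wy n) (Coord.toLaurent n q (Coord.y n q)) (ly n) := by
  rw [toLaurent_y]
  have := ((Lead.self (lxInv_mem n)).mul (lead_centerPol q)).neg
  rwa [← toLex_add, Prod.mk_add_mk, add_zero, zero_add] at this

theorem lx_ne_zero : lx ≠ 0 := AddMonoidAlgebra.single_ne_zero.2 one_ne_zero
theorem lz_ne_zero : lz ≠ 0 := AddMonoidAlgebra.single_ne_zero.2 one_ne_zero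
theorem lt_ne_zero : lt ≠ 0 := AddMonoidAlgebra.single_ne_zero.2 one_ne_zero
theorem lxInv_ne_zero : lxInv n ≠ 0 := AddMonoidAlgebra.single_ne_zero.2 one_ne_zero

theorem lz_sq_add_lt_cube_ne_zero (a b : ℂ) (hab : a ≠ 0 ∨ b ≠ 0) :
    algebraMap ℂ Laurent a * lz ^ 2 + algebraMap ℂ Laurent b * lt ^ 3 ≠ 0 := by
  rw [lz_pow, lt_pow, algebraMap_laurent, algebraMap_laurent, AddMonoidAlgebra.single_mul_single,
    AddMonoidAlgebra.single_mul_single]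
  intro h
  rcases hab with ha | hb
  · have := congrArg (fun s : Laurent => s.coeff (0, 2, 0)) h
    simp [ha] at this
  · have := congrArg (fun s : Laurent => s.coeff (0, 0, 3)) h
    simp [hb] at this

theorem ly_ne_zero : ly n ≠ 0 := by
  have := lz_sq_add_lt_cube_ne_zero 1 1 (Or.inl one_ne_zero)
  rw [map_one, one_mul, one_mul] at this
  exact neg_ne_zero.2 (mul_ne_zero lxInv_ne_zero this)

theorem lx_pow_mul_ly : lx ^ n * ly n + lz ^ 2 + lt ^ 3 = 0 := by
  rw [ly, mul_neg, ← mul_assoc, lx_pow_mul_lxInv]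
  ring

/-- Each y contributes a pole of order at most n along x = 0. The bound keeps lower powers of y
below the weight of the top term. -/
theorem toLaurent_evalY_mem (P : Polynomial Pol3) {N : ℕ} (hP : P.natDegree ≤ N) :
    Coord.toLaurent n q (evalY n q P) ∈ supp {m | -m.1 ≤ n * N} := by
  rw [evalY, Polynomial.coe_eval₂RingHom, Polynomial.eval₂_eq_sum_range, map_sum]
  refine sum_mem fun j hj => ?_
  rw [map_mul, map_pow, AlgHom.coe_toRingHom, toLaurent_base]
  have hy : ∀ j : ℕ, Coord.toLaurent n q (Coord.y n q) ^ j ∈ supp {m | -m.1 ≤ n * j} := by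
    intro j
    induction j with
    | zero => exact single_mem_supp (by simp) _
    | succ j ih =>
      rw [pow_succ]
      refine mul_mem_supp (Q := {m | -m.1 ≤ n}) ?_ ih ?_
      · intro p hp r hr
        simp only [Set.mem_ofPred_eq, Prod.fst_add] at *
        push_cast
        linarith
      · rw [toLaurent_y, ← neg_mul]
        refine mul_mem_supp (P := {(-(n : ℤ), 0, 0)}) ?_
          (neg_mem (single_mem_supp (Set.mem_singleton _) _)) (toLaurent_mem_supp _)
        rintro p hp r ⟨h1, h2, h3⟩
        rw [Set.mem_singleton_iff.1 hp]
        simp only [Set.mem_ofPred_eq, Prod.fst_add]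
        linarith
  refine mul_mem_supp ?_ (toLaurent_mem_supp _) (hy j)
  rintro p ⟨h1, h2, h3⟩ r hr
  have hjN : (n : ℤ) * j ≤ n * N := by
    have := Finset.mem_range.1 hj
    exact_mod_cast Nat.mul_le_mul_left n (by omega : j ≤ N)
  simp only [Set.mem_ofPred_eq, Prod.fst_add] at *
  linarith

theorem exists_coeff_ne_zero_of_not_dvd {b : Pol3} (h : ¬ X 0 ^ n ∣ b) :
    ∃ m, b.coeff m ≠ 0 ∧ m 0 < n := by
  by_contra! hc
  apply h
  rw [X_pow_eq_monomial, monomial_one_dvd_iff_modMonomial_eq_zero]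
  ext m
  by_cases hm : Finsupp.single 0 n ≤ m
  · rw [coeff_modMonomial_of_le _ hm, coeff_zero]
  · rw [coeff_modMonomial_of_not_le _ hm, coeff_zero]
    by_contra hne
    refine hm (Finsupp.single_le_iff.2 (hc m hne))

/-- Induction on the degree in y: a leading coefficient divisible by xⁿ is removed with xⁿy = -f.
Otherwise the top term dominates and its leading form is the answer, with no cancellation against
lower powers of y. -/
theorem exists_lead_evalY (P : Polynomial Pol3) (hP : evalY n q P ≠ 0) :
    ∃ (J : ℕ) (e : Wt) (h : Laurent), h ≠ 0 ∧ h ∈ homog e ∧ h ∈ supp nonneg ∧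
      Lead (J • wy n + e) (Coord.toLaurent n q (evalY n q P)) (ly n ^ J * h) ∧
      (J = 0 → ∃ b, base n q b = evalY n q P) := by
  obtain ⟨N, hN⟩ : ∃ N, P.natDegree = N := ⟨_, rfl⟩
  induction N using Nat.strong_induction_on generalizing P with
  | _ N ih =>
  have hP0 : P ≠ 0 := by
    rintro rfl
    exact hP (map_zero _)
  rcases Nat.eq_zero_or_pos N with rfl | hpos
  · obtain ⟨b, rfl⟩ : ∃ b, P = Polynomial.C b := ⟨_, Polynomial.eq_C_of_natDegree_eq_zero hN⟩
    rw [evalY_C] at hP ⊢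
    rw [toLaurent_base]
    have hb : toLaurent b ≠ 0 := fun h0 => hP (by
      rw [toLaurent_injective (h0.trans (map_zero _).symm), map_zero])
    obtain ⟨e, u, hu, hl⟩ := exists_lead hb
    refine ⟨0, e, u, hu, hl.1, hl.mem_supp (toLaurent_mem_supp _), ?_, fun _ => ⟨_, rfl⟩⟩
    simpa using hl
  by_cases hdvd : X 0 ^ n ∣ P.leadingCoeff
  · obtain ⟨b, hb⟩ := hdvd
    -- The top term xⁿb yᴺ equals -bf yᴺ⁻¹ in the coordinate ring.
    let P' := P.eraseLead + Polynomial.C (-(b * centerPol q)) * Polynomial.X ^ (N - 1)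
    have heq : evalY n q P' = evalY n q P := by
      conv_rhs => rw [← Polynomial.eraseLead_add_C_mul_X_pow P]
      rw [map_add, map_add, map_mul, map_mul, map_pow, map_pow, evalY_X, evalY_C, evalY_C, hb, hN,
        map_neg, map_mul, map_mul, map_pow]
      have e1 : Coord.y n q ^ N = Coord.y n q * Coord.y n q ^ (N - 1) := by
        rw [← pow_succ']; congr 1; omega
      rw [e1]
      linear_combination (-(base n q b) * Coord.y n q ^ (N - 1)) * (Coord.relation (n := n) (q := q))
    have hdeg : P'.natDegree < N := by
      have h1 := Polynomial.eraseLead_natDegree_le P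
      have h2 := Polynomial.natDegree_C_mul_X_pow_le (-(b * centerPol q)) (N - 1)
      have h3 := Polynomial.natDegree_add_le P.eraseLead
        (Polynomial.C (-(b * centerPol q)) * Polynomial.X ^ (N - 1))
      have h4 : P'.natDegree ≤ N - 1 := h3.trans (max_le (by omega) h2)
      omega
    rw [← heq] at hP ⊢
    exact ih _ hdeg P' hP rfl
  · have hb : toLaurent P.leadingCoeff ≠ 0 := fun h0 => hP0 (Polynomial.leadingCoeff_eq_zero.1
      (toLaurent_injective (h0.trans (map_zero _).symm)))
    obtain ⟨e, u, hu, hl⟩ := exists_lead hb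
    obtain ⟨m, hm, hmn⟩ := exists_coeff_ne_zero_of_not_dvd hdvd
    -- A monomial with x-exponent below n gives the top term first weight above nN - n, the pole
    -- bound for the remaining terms.
    have hwt : -(n : ℤ) < (ofLex e).1 := by
      rw [← coeff_toLaurent] at hm
      have := hl.wt_le hm
      rw [Prod.Lex.le_iff] at this
      have h1 : (ofLex (wt (expo m))).1 = -(m 0 : ℤ) := rfl
      rw [h1] at this
      omega
    refine ⟨N, e, u, hu, hl.1, hl.mem_supp (toLaurent_mem_supp _), ?_, fun h => by omega⟩
    conv in evalY n q P => rw [← Polynomial.eraseLead_add_C_mul_X_pow P]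
    rw [map_add, map_add, map_mul, map_mul, map_pow, map_pow, evalY_X, evalY_C, hN, toLaurent_base,
      add_comm (Coord.toLaurent n q _), mul_comm (toLaurent _)]
    refine ((lead_y.pow N).mul hl).add_below ?_
    refine supp_mono ?_ (toLaurent_evalY_mem P.eraseLead (N := N - 1)
      ((Polynomial.eraseLead_natDegree_le P).trans (by omega)))
    rintro ⟨i, j, k⟩ hi
    rw [Set.mem_ofPred_eq] at hi ⊢
    rw [wt_mk, Prod.Lex.lt_iff]
    left
    have h1 : (ofLex (N • wy n + e)).1 = N * n + (ofLex e).1 := by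
      simp [wy]
    rw [h1]
    obtain ⟨r, rfl⟩ := Nat.exists_eq_add_of_lt hpos
    simp only [zero_add, Nat.add_sub_cancel, ofLex_toLex] at *
    push_cast
    linarith

theorem exists_lead_coord {a : Coord n q} (ha : a ≠ 0) :
    ∃ (J : ℕ) (e : Wt) (h : Laurent), h ≠ 0 ∧ h ∈ homog e ∧ h ∈ supp nonneg ∧
      Lead (J • wy n + e) (Coord.toLaurent n q a) (ly n ^ J * h) ∧
      (J = 0 → ∃ b, base n q b = a) := by
  obtain ⟨P, rfl⟩ := evalY_surjective a
  exact exists_lead_evalY P ha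

theorem Coord.toLaurent_injective : Function.Injective (Coord.toLaurent n q) := by
  rw [injective_iff_map_eq_zero]
  intro a ha
  by_contra hne
  obtain ⟨J, e, h, h0, -, -, hl, -⟩ := exists_lead_coord hne
  rw [ha] at hl
  exact mul_ne_zero (pow_ne_zero _ ly_ne_zero) h0 hl.eq_zero

theorem base_injective : Function.Injective (base n q) := fun a b h =>
  toLaurent_injective (by rw [← toLaurent_base (n := n) (q := q), h, toLaurent_base])

instance : IsDomain (Coord n q) := Coord.toLaurent_injective.isDomain (Coord.toLaurent n q)

end AffineThreefold
end

/-! ### Kernels of locally nilpotent derivations -/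

noncomputable section
namespace AffineThreefold

theorem toLaurent_mem_nilSubalgebra {E : Derivation ℂ Laurent Laurent}
    (hx : lx ∈ E.nilSubalgebra) (hz : lz ∈ E.nilSubalgebra) (ht : lt ∈ E.nilSubalgebra)
    {h : Laurent} (hh : h ∈ supp nonneg) : h ∈ E.nilSubalgebra := by
  obtain ⟨p, rfl⟩ := exists_toLaurent_eq hh
  induction p using MvPolynomial.induction_on with
  | C c => rw [toLaurent, aeval_C]; exact Subalgebra.algebraMap_mem _ c
  | add p r hp hr =>
    rw [map_add]
    exact add_mem (hp (toLaurent_mem_supp _)) (hr (toLaurent_mem_supp _))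
  | mul_X p i hp =>
    rw [map_mul]
    refine mul_mem (hp (toLaurent_mem_supp _)) ?_
    fin_cases i
    · exact toLaurent_X0 ▸ hx
    · exact toLaurent_X1 ▸ hz
    · exact toLaurent_X2 ▸ ht

theorem IsPrimeForm.mem_supp {r : Laurent} (hr : IsPrimeForm r) : r ∈ supp nonneg := by
  cases hr with
  | x => exact toLaurent_X0 ▸ toLaurent_mem_supp _
  | t => exact toLaurent_X2 ▸ toLaurent_mem_supp _
  | z => exact toLaurent_X1 ▸ toLaurent_mem_supp _
  | zt c =>
    have : lz ^ 2 + algebraMap ℂ Laurent c * lt ^ 3 = toLaurent (X 1 ^ 2 + C c * X 2 ^ 3) := by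
      simp [toLaurent]
    exact this ▸ toLaurent_mem_supp _

section Homogeneous

variable {n : ℕ} (hn : 2 ≤ n) {u : Fin 3 → Laurent} (hu : u ≠ 0)
  (hx : lx ∈ (logDer u).nilSubalgebra) (hz : lz ∈ (logDer u).nilSubalgebra)
  (ht : lt ∈ (logDer u).nilSubalgebra) (hy : logDer u (ly n) = 0)

include hu hz ht hy

/-- If x were killed, so would be z² + t³ = -xⁿŷ; then z and t are killed as well and the derivation
is zero. -/
theorem logDer_lx_ne_zero : logDer u lx ≠ 0 := by
  intro h
  have hc : logDer u (-(lx ^ n * ly n)) = 0 := by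
    rw [map_neg, Derivation.leibniz, Derivation.leibniz_pow, h, hy]
    simp
  have hc0 : -(lx ^ n * ly n) ≠ 0 := neg_ne_zero.2 (mul_ne_zero (pow_ne_zero _ lx_ne_zero)
    ly_ne_zero)
  have h1 : (1 : Laurent) * lz ^ 2 + 1 * lt ^ 3 = -(lx ^ n * ly n) := by
    linear_combination lx_pow_mul_ly (n := n)
  have dz := Derivation.apply_eq_zero_of_pow_add_pow (D := logDer u) le_rfl (by norm_num)
    one_ne_zero one_ne_zero hc0 (by simp) (by simp) hc hz ht h1
  rw [add_comm] at h1
  have dt := Derivation.apply_eq_zero_of_pow_add_pow (D := logDer u) (by norm_num) le_rfl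
    one_ne_zero one_ne_zero hc0 (by simp) (by simp) hc ht hz h1
  rw [logDer_lx] at h
  rw [logDer_lz] at dz
  rw [logDer_lt] at dt
  apply hu
  ext1 i
  fin_cases i
  · exact (mul_eq_zero.1 h).resolve_right lx_ne_zero
  · exact (mul_eq_zero.1 dz).resolve_right lz_ne_zero
  · exact (mul_eq_zero.1 dt).resolve_right lt_ne_zero

include hn hx

/-- For c = 1 the form is -xⁿŷ, so its factor x would be killed. For c ≠ 1, ŷxⁿ + (1 - c)t³ = -(z² +
ct³) is a relation of Mason–Stothers type with n ≥ 2, and again x would be killed. -/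
theorem logDer_zt_ne_zero (c : ℂ) : logDer u (lz ^ 2 + algebraMap ℂ Laurent c * lt ^ 3) ≠ 0 := by
  intro h
  have hne := lz_sq_add_lt_cube_ne_zero 1 c (Or.inl one_ne_zero)
  rw [map_one, one_mul] at hne
  apply logDer_lx_ne_zero hu hz ht hy
  by_cases hc : c = 1
  · subst hc
    obtain ⟨r, rfl⟩ := Nat.exists_eq_add_of_le hn
    have h1 : lx * (lx ^ (1 + r) * ly (2 + r)) =
        -(lz ^ 2 + algebraMap ℂ Laurent 1 * lt ^ 3) := by
      rw [map_one]
      linear_combination lx_pow_mul_ly (n := 2 + r)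
    refine Derivation.apply_eq_zero_of_mul hx (b := lx ^ (1 + r) * ly (2 + r)) ?_ ?_ ?_
    · exact mul_mem (pow_mem hx _) (Derivation.mem_nilSubalgebra_iff.2 ⟨1, hy⟩)
    · rw [h1]; exact neg_ne_zero.2 hne
    · rw [h1, map_neg, h, neg_zero]
  · refine Derivation.apply_eq_zero_of_pow_add_pow (D := logDer u) (α := ly n)
      (β := algebraMap ℂ Laurent (1 - c)) hn (by norm_num : 2 ≤ 3) ly_ne_zero ?_
      (neg_ne_zero.2 hne) hy (Derivation.map_algebraMap _ _) (by rw [map_neg, h, neg_zero]) hx ht ?_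
    · rw [algebraMap_laurent]
      exact AddMonoidAlgebra.single_ne_zero.2 (sub_ne_zero.2 (Ne.symm hc))
    · rw [map_sub, map_one]
      linear_combination lx_pow_mul_ly (n := n)

theorem IsPrimeForm.logDer_ne_zero {r : Laurent} (hr : IsPrimeForm r) : logDer u r ≠ 0 := by
  cases hr with
  | x => exact logDer_lx_ne_zero hu hz ht hy
  | t =>
    intro h
    refine logDer_lx_ne_zero hu hz ht hy ?_
    refine Derivation.apply_eq_zero_of_pow_add_pow (D := logDer u) (α := ly n) (β := 1)
      (c := -lt ^ 3) hn le_rfl ly_ne_zero one_ne_zero (neg_ne_zero.2 (pow_ne_zero _ lt_ne_zero)) hy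
      (by simp) ?_ hx hz ?_
    · rw [map_neg, Derivation.leibniz_pow, h]; simp
    · linear_combination lx_pow_mul_ly (n := n)
  | z =>
    intro h
    refine logDer_zt_ne_zero hn hu hx hz ht hy 0 ?_
    rw [map_zero, zero_mul, add_zero, Derivation.leibniz_pow, h]
    simp
  | zt c => exact logDer_zt_ne_zero hn hu hx hz ht hy c

variable {δ : Wt}
  (hform : ∀ (d : Wt) (s : Laurent), s ∈ homog d → s ∈ supp nonneg → ∀ k,
    (logDer u)^[k] s ≠ 0 → ∃ (J : ℕ) (e : Wt) (h : Laurent), h ≠ 0 ∧ h ∈ homog e ∧ h ∈ supp nonneg ∧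
      d + k • δ = J • wy n + e ∧ (logDer u)^[k] s = ly n ^ J * h)
include hform

/-- Up to a factorial, the leading coefficient is the last nonzero derivative of s, hence lies in
the kernel. By `hform`, the only trace left of the coordinate ring, it is ŷᴶh; a prime factor of h
would lie in the kernel too, so h is constant. -/
theorem leadingCoeff_eq {d : Wt} {s : Laurent} (hd : s ∈ homog d) (hs : s ∈ supp nonneg)
    (h0 : s ≠ 0) {p : Polynomial Laurent} (hp : (p : PowerSeries Laurent) = expSeries (logDer u) s) :
    ∃ (c : ℂ) (J : ℕ), c ≠ 0 ∧ p.leadingCoeff = algebraMap ℂ Laurent c * ly n ^ J ∧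
      d + p.natDegree • δ = J • wy n := by
  have hp0 := Derivation.coe_eq_expSeries_ne_zero hp h0
  have h1 : (logDer u)^[p.natDegree] s ≠ 0 := fun h =>
    hp0 (Polynomial.leadingCoeff_eq_zero.1 ((Derivation.coeff_eq_zero_iff_iterate hp _).2 h))
  have h2 : logDer u ((logDer u)^[p.natDegree] s) = 0 := by
    rw [← Function.iterate_succ_apply' (logDer u)]
    exact (Derivation.coeff_eq_zero_iff_iterate hp _).1
      (Polynomial.coeff_eq_zero_of_natDegree_lt (Nat.lt_succ_self _))
  obtain ⟨J, e, h, hh0, he, hnn, hw, heq⟩ := hform d s hd hs _ h1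
  rcases exists_isPrimeForm_mul he hnn hh0 with ⟨c, hc, rfl⟩ | ⟨r, hr, h', hh', rfl⟩
  · refine ⟨((p.natDegree.factorial : ℂ)⁻¹) * c, J, mul_ne_zero (inv_ne_zero ?_) hc, ?_, ?_⟩
    · exact_mod_cast p.natDegree.factorial_ne_zero
    · rw [Polynomial.leadingCoeff, Derivation.coeff_of_coe_eq_expSeries hp, heq, Algebra.smul_def,
        map_mul]
      ring
    · have : wt 0 = e := he 0 (by
        rw [algebraMap_laurent, AddMonoidAlgebra.coeff_single, Finsupp.single_eq_same]; exact hc)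
      rw [hw, ← this, map_zero, add_zero]
  · exfalso
    have e1 : ly n ^ J * (r * h') = r * (ly n ^ J * h') := by ring
    rw [heq, e1] at h1 h2
    refine hr.logDer_ne_zero hn hu hx hz ht hy (Derivation.apply_eq_zero_of_mul ?_ ?_ h1 h2)
    · exact toLaurent_mem_nilSubalgebra hx hz ht hr.mem_supp
    · exact mul_mem (pow_mem (Derivation.mem_nilSubalgebra_iff.2 ⟨1, hy⟩) _)
        (toLaurent_mem_nilSubalgebra hx hz ht hh')

theorem false_of_homogeneous : False := by
  obtain ⟨p, hp⟩ := hz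
  obtain ⟨r, hr⟩ := ht
  have main := fun {d s} => leadingCoeff_eq hn hu hx ⟨p, hp⟩ ⟨r, hr⟩ hy hform (d := d) (s := s)
  obtain ⟨a, J, ha, hpl, hpw⟩ := main lz_mem IsPrimeForm.z.mem_supp lz_ne_zero hp
  obtain ⟨b, I, hb, hrl, hrw⟩ := main lt_mem IsPrimeForm.t.mem_supp lt_ne_zero hr
  have w1 := congrArg (fun d : Wt => (ofLex d).1) hpw
  have w2 := congrArg (fun d : Wt => (ofLex d).2) hpw
  have w3 := congrArg (fun d : Wt => (ofLex d).1) hrw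
  have w4 := congrArg (fun d : Wt => (ofLex d).2) hrw
  simp [wy] at w1 w2 w3 w4
  set δ1 := (ofLex δ).1
  set δ2 := (ofLex δ).2
  have hn' : (n : ℤ) ≠ 0 := by omega
  -- The linear form 6w₁ - nw₂ vanishes on the weight (n, 6) of ŷ, which eliminates the unknown
  -- exponents J and I.
  have o1 : (p.natDegree : ℤ) * (6 * δ1 - n * δ2) = 3 * n := by
    linear_combination 6 * w1 - n * w2
  have o2 : (r.natDegree : ℤ) * (6 * δ1 - n * δ2) = 2 * n := by
    linear_combination 6 * w3 - n * w4
  have hω : 6 * δ1 - n * δ2 ≠ 0 := by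
    intro h
    rw [h, mul_zero] at o2
    omega
  have hdeg : 2 * p.natDegree = 3 * r.natDegree := by
    have : (2 * p.natDegree : ℤ) = 3 * r.natDegree :=
      mul_right_cancel₀ hω (by linear_combination 2 * o1 - 3 * o2)
    exact_mod_cast this
  have hJI : 2 * J = 3 * I := by
    have h1 : (2 * p.natDegree : ℤ) = 3 * r.natDegree := by exact_mod_cast hdeg
    have : (2 * J : ℤ) = 3 * I :=
      mul_right_cancel₀ hn' (by linear_combination (-2) * w1 + 3 * w3 + δ1 * h1)
    exact_mod_cast this
  -- This c cancels the top coefficients a²ŷ²ᴶ and b³ŷ³ᴵ of the series of z² and t³, whose degrees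
  -- and powers of ŷ agree.
  let c : ℂ := -(a ^ 2 / b ^ 3)
  let P : Polynomial Laurent := p ^ 2 + Polynomial.C (algebraMap ℂ Laurent c) * r ^ 3
  have hP : (P : PowerSeries Laurent) =
      expSeries (logDer u) (lz ^ 2 + algebraMap ℂ Laurent c * lt ^ 3) := by
    rw [Polynomial.coe_add, Polynomial.coe_mul, Polynomial.coe_pow, Polynomial.coe_pow,
      Polynomial.coe_C, hp, hr, Derivation.expSeries_add, Derivation.expSeries_mul,
      Derivation.expSeries_of_apply_eq_zero _ (Derivation.map_algebraMap _ _)]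
    simp only [pow_succ, pow_zero, one_mul, Derivation.expSeries_mul]
  have hPd : P.natDegree ≤ 2 * p.natDegree := by
    refine (Polynomial.natDegree_add_le _ _).trans (max_le ?_ ?_)
    · exact Polynomial.natDegree_pow_le
    · refine (Polynomial.natDegree_C_mul_le _ _).trans ?_
      rw [hdeg]
      exact Polynomial.natDegree_pow_le
  have hPc : P.coeff (2 * p.natDegree) = 0 := by
    rw [Polynomial.coeff_add, Polynomial.coeff_C_mul]
    conv_lhs => arg 2; rw [hdeg]
    rw [Polynomial.coeff_pow_mul_natDegree, Polynomial.coeff_pow_mul_natDegree, hpl, hrl]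
    have h1 : (algebraMap ℂ Laurent a) ^ 2 + algebraMap ℂ Laurent c * algebraMap ℂ Laurent b ^ 3
        = 0 := by
      rw [← map_pow, ← map_pow, ← map_mul, ← map_add]
      have : a ^ 2 + c * b ^ 3 = 0 := by simp only [c]; field_simp; ring
      rw [this, map_zero]
    have h2 : (ly n ^ J) ^ 2 = (ly n ^ I) ^ 3 := by
      rw [← pow_mul, ← pow_mul, mul_comm J, mul_comm I, hJI]
    linear_combination (ly n ^ J) ^ 2 * h1 - algebraMap ℂ Laurent c * algebraMap ℂ Laurent b ^ 3 * h2
  have hne := lz_sq_add_lt_cube_ne_zero 1 c (Or.inl one_ne_zero)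
  rw [map_one, one_mul] at hne
  have hhom : lz ^ 2 + algebraMap ℂ Laurent c * lt ^ 3 ∈ homog (toLex (0, 6)) := by
    rw [← Algebra.smul_def]
    exact add_mem lz_sq_mem (Submodule.smul_mem _ _ lt_cube_mem)
  obtain ⟨-, K, -, -, hPw⟩ := main hhom (IsPrimeForm.zt c).mem_supp hne hP
  have w5 := congrArg (fun d : Wt => (ofLex d).1) hPw
  have w6 := congrArg (fun d : Wt => (ofLex d).2) hPw
  simp [wy] at w5 w6
  -- The weight (0, 6) of z² + ct³ is twice that of z, so the same elimination gives twice the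
  -- degree, contradicting the cancellation.
  have hPN : P.natDegree = 2 * p.natDegree := by
    have : (P.natDegree : ℤ) = 2 * p.natDegree :=
      mul_right_cancel₀ hω (by linear_combination 6 * w5 - n * w6 - 2 * o1)
    exact_mod_cast this
  rw [← hPN] at hPc
  exact Derivation.coe_eq_expSeries_ne_zero hP hne (Polynomial.leadingCoeff_eq_zero.1 hPc)

end Homogeneous

variable {n : ℕ} {q : Pol3}

/-- The logarithmic derivatives of `x`, `z`, `t` under a derivation of the coordinate ring. -/
def logCoeff (D : Derivation ℂ (Coord n q) (Coord n q)) : Fin 3 → Laurent :=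
  ![AddMonoidAlgebra.single (-1, 0, 0) 1 * Coord.toLaurent n q (D (base n q (X 0))),
    AddMonoidAlgebra.single (0, -1, 0) 1 * Coord.toLaurent n q (D (base n q (X 1))),
    AddMonoidAlgebra.single (0, 0, -1) 1 * Coord.toLaurent n q (D (base n q (X 2)))]

theorem logDer_logCoeff_base_X (D : Derivation ℂ (Coord n q) (Coord n q)) (i : Fin 3) :
    logDer (logCoeff D) (toLaurent (X i)) = Coord.toLaurent n q (D (base n q (X i))) := by
  have h : ∀ (m : Expo) (s : Laurent), AddMonoidAlgebra.single (-m) 1 * s *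
      AddMonoidAlgebra.single m 1 = s := by
    intro m s
    rw [mul_right_comm, AddMonoidAlgebra.single_mul_single, neg_add_cancel, mul_one,
      ← AddMonoidAlgebra.one_def, one_mul]
  fin_cases i
  · exact (congrArg _ toLaurent_X0).trans ((logDer_lx _).trans (h (1, 0, 0) _))
  · exact (congrArg _ toLaurent_X1).trans ((logDer_lz _).trans (h (0, 1, 0) _))
  · exact (congrArg _ toLaurent_X2).trans ((logDer_lt _).trans (h (0, 0, 1) _))

theorem logDer_logCoeff_base (D : Derivation ℂ (Coord n q) (Coord n q)) (b : Pol3) :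
    logDer (logCoeff D) (toLaurent b) = Coord.toLaurent n q (D (base n q b)) := by
  induction b using MvPolynomial.induction_on with
  | C c =>
    rw [toLaurent, aeval_C, Derivation.map_algebraMap, ← algebraMap_eq, AlgHom.commutes,
      Derivation.map_algebraMap, map_zero]
  | add p r hp hr => simp only [map_add, hp, hr]
  | mul_X p i hp =>
    simp only [map_mul, Derivation.leibniz, hp, map_add, smul_eq_mul, logDer_logCoeff_base_X,
      toLaurent_base]

/-- Both sides agree on x, z, t by the choice of logarithmic derivatives; agreement on y follows by
applying them to xⁿy = -f and cancelling xⁿ. -/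
theorem logDer_logCoeff (D : Derivation ℂ (Coord n q) (Coord n q)) (a : Coord n q) :
    logDer (logCoeff D) (Coord.toLaurent n q a) = Coord.toLaurent n q (D a) := by
  have hy : logDer (logCoeff D) (Coord.toLaurent n q (Coord.y n q)) =
      Coord.toLaurent n q (D (Coord.y n q)) := by
    have h1 := Coord.relation (n := n) (q := q)
    have h2 := congrArg (fun a => Coord.toLaurent n q (D a)) h1
    have h3 := congrArg (fun a => logDer (logCoeff D) (Coord.toLaurent n q a)) h1
    rw [← map_pow] at h2 h3
    simp only [map_neg, map_mul, Derivation.leibniz, smul_eq_mul, map_add, toLaurent_base,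
      logDer_logCoeff_base] at h2 h3
    have h4 : toLaurent (X 0 ^ n) ≠ 0 := by
      rw [map_pow, toLaurent_X0]; exact pow_ne_zero _ lx_ne_zero
    refine mul_left_cancel₀ h4 ?_
    linear_combination h3 - h2
  obtain ⟨P, rfl⟩ := evalY_surjective a
  induction P using Polynomial.induction_on' with
  | add p r hp hr => simp only [map_add, hp, hr]
  | monomial k b =>
    rw [← Polynomial.C_mul_X_pow_eq_monomial, map_mul, map_pow, evalY_C, evalY_X]
    simp only [map_mul, map_pow, Derivation.leibniz, Derivation.leibniz_pow, smul_eq_mul, map_add,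
      toLaurent_base, logDer_logCoeff_base, hy, nsmul_eq_mul, map_natCast]

theorem logDer_logCoeff_iterate (D : Derivation ℂ (Coord n q) (Coord n q)) (a : Coord n q) (k : ℕ) :
    (logDer (logCoeff D))^[k] (Coord.toLaurent n q a) = Coord.toLaurent n q (D^[k] a) :=
  (Function.Semiconj.iterate_right (f := Coord.toLaurent n q) (ga := D)
    (gb := logDer (logCoeff D)) (fun a => (logDer_logCoeff D a).symm) k a).symm

/-- The kernel of a nonzero locally nilpotent derivation of the coordinate ring of `V_{n,q}` consists
of polynomials in `x`, `z` and `t`. -/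
theorem exists_base_eq_of_apply_eq_zero (hn : 2 ≤ n) (D : Derivation ℂ (Coord n q) (Coord n q))
    (hD : D ≠ 0) (hnil : ∀ a, ∃ k, D^[k] a = 0) {a : Coord n q} (ha : D a = 0) :
    ∃ b, base n q b = a := by
  by_cases ha0 : a = 0
  · exact ⟨0, by rw [map_zero, ha0]⟩
  obtain ⟨J, e, h, h0, he, hnn, hl, hJ⟩ := exists_lead_coord ha0
  by_cases hJ0 : J = 0
  · exact hJ hJ0
  exfalso
  have hθ : logCoeff D ≠ 0 := by
    intro h
    apply hD
    ext a
    apply Coord.toLaurent_injective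
    rw [← logDer_logCoeff, h]
    simp [logDer]
  obtain ⟨δ, u, hu, hlead⟩ := exists_logDer_lead hθ
  have hit : ∀ {d : Wt} {a : Coord n q} {h : Laurent}, Lead d (Coord.toLaurent n q a) h → ∀ k,
      Lead (d + k • δ) (Coord.toLaurent n q (D^[k] a)) ((logDer u)^[k] h) := by
    intro d a h hl k
    rw [← logDer_logCoeff_iterate]
    exact hl.logDer_iterate hlead k
  have hnil' : ∀ {d : Wt} {a : Coord n q} {h : Laurent}, Lead d (Coord.toLaurent n q a) h →
      h ∈ (logDer u).nilSubalgebra := by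
    intro d a h hl
    obtain ⟨k, hk⟩ := hnil a
    have := hit hl k
    rw [hk, map_zero] at this
    exact Derivation.mem_nilSubalgebra_iff.2 ⟨k, this.eq_zero⟩
  have hsuppnil : ∀ {d : Wt} {s : Laurent}, s ∈ homog d → s ∈ supp nonneg →
      s ∈ (logDer u).nilSubalgebra := by
    intro d s hs hs'
    obtain ⟨b, rfl⟩ := exists_toLaurent_eq hs'
    rw [← toLaurent_base (n := n) (q := q)] at hs ⊢
    exact hnil' (Lead.self hs)
  have hx := hsuppnil lx_mem IsPrimeForm.x.mem_supp
  have hz := hsuppnil lz_mem IsPrimeForm.z.mem_supp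
  have ht := hsuppnil lt_mem IsPrimeForm.t.mem_supp
  have hyn : ly n ∈ (logDer u).nilSubalgebra := hnil' (lead_y (q := q))
  have hker : logDer u (ly n ^ J * h) = 0 := by
    have := hit hl 1
    rw [Function.iterate_one, ha, map_zero] at this
    exact this.eq_zero
  -- The leading form ŷᴶh of the kernel element is killed and J > 0, so factorial closedness applies
  -- to its factor ŷ.
  have hy : logDer u (ly n) = 0 := by
    obtain ⟨r, rfl⟩ := Nat.exists_eq_succ_of_ne_zero hJ0
    have e1 : ly n ^ (r + 1) * h = ly n * (ly n ^ r * h) := by ring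
    rw [Nat.succ_eq_add_one, e1] at hker
    refine Derivation.apply_eq_zero_of_mul hyn ?_ ?_ hker
    · exact mul_mem (pow_mem hyn _) (hsuppnil he hnn)
    · exact mul_ne_zero ly_ne_zero (mul_ne_zero (pow_ne_zero _ ly_ne_zero) h0)
  refine false_of_homogeneous hn hu hx hz ht hy (δ := δ) ?_
  intro d s hs hs' k hk
  -- A homogeneous polynomial is itself an element of the coordinate ring, so its nonzero iterates
  -- under the leading derivation are leading forms of elements there.
  obtain ⟨b, rfl⟩ := exists_toLaurent_eq hs'
  have hl2 := hit (a := base n q b) (Lead.self (by rwa [toLaurent_base])) k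
  rw [toLaurent_base] at hl2
  have hne : D^[k] (base n q b) ≠ 0 := by
    intro h
    rw [h, map_zero] at hl2
    exact hk hl2.eq_zero
  obtain ⟨J', e', h', h0', he', hnn', hl', -⟩ := exists_lead_coord hne
  obtain ⟨e1, e2⟩ := hl2.unique_of_ne_zero hl' hk (mul_ne_zero (pow_ne_zero _ ly_ne_zero) h0')
  exact ⟨J', e', h', h0', he', hnn', e1, e2⟩

end AffineThreefold
end

/-! ### Triangular derivations and restriction to ℂ[x, z, t] -/

noncomputable section
namespace AffineThreefold

variable {n : ℕ} {q : Pol3}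

theorem incl_X (i : Fin 3) : incl (X i) = X (![0, 2, 3] i) := by simp [incl]

theorem base_X0_ne_zero : base n q (X 0) ≠ 0 := fun h =>
  X_ne_zero (R := ℂ) (0 : Fin 3) (base_injective (h.trans (map_zero _).symm))

/-- The triangular derivation `xⁿ ∂ᵢ - (∂ᵢ f) ∂_y` of the coordinate ring, where
`f = z² + t³ + x q`. -/
theorem exists_triangular_derivation (n : ℕ) (q : Pol3) {i : Fin 3} (hi : i ≠ 0) :
    ∃ D : Derivation ℂ (Coord n q) (Coord n q),
      (∀ b, D (base n q b) = base n q (X 0 ^ n * pderiv i b)) ∧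
        D (Coord.y n q) = -base n q (pderiv i (centerPol q)) := by
  let d : Derivation ℂ Pol4 Pol4 := mkDerivation ℂ fun j =>
    if j = 1 then -incl (pderiv i (centerPol q)) else if j = ![0, 2, 3] i then X 0 ^ n else 0
  have hd : ∀ b, d (incl b) = X 0 ^ n * incl (pderiv i b) := by
    intro b
    induction b using MvPolynomial.induction_on with
    | C c => simp [incl]
    | add p r hp hr => simp only [map_add, hp, hr, mul_add]
    | mul_X p j hp =>
      have hj : d (incl (X j)) = X 0 ^ n * incl (pderiv i (X j)) := by
        rw [incl_X, mkDerivation_X, pderiv_X]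
        fin_cases i <;> fin_cases j <;> simp at hi ⊢
      simp only [map_mul, Derivation.leibniz, hp, hj, smul_eq_mul, map_add]
      ring
  have hdy : d (X 1) = -incl (pderiv i (centerPol q)) := by
    rw [mkDerivation_X, if_pos rfl]
  have hd0 : d (X 0) = 0 := by
    have := hd (X 0)
    rwa [incl_X0, pderiv_X_of_ne hi.symm, map_zero, mul_zero] at this
  have hdeq : d (equation n q) = 0 := by
    rw [equation_eq, map_add, hd, Derivation.leibniz, Derivation.leibniz_pow, hd0, hdy]
    simp
  have hker : ∀ p, Coord.mk n q p = 0 → Coord.mk n q (d p) = 0 := by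
    intro p hp
    obtain ⟨r, rfl⟩ := Ideal.mem_span_singleton.1 (Ideal.Quotient.eq_zero_iff_mem.1 hp)
    rw [Derivation.leibniz, hdeq, smul_zero, add_zero, smul_eq_mul]
    exact Ideal.Quotient.eq_zero_iff_mem.2 (Ideal.mul_mem_right _ _ (Ideal.subset_span rfl))
  have hs : Function.Surjective (Coord.mk n q) := Ideal.Quotient.mkₐ_surjective _ _
  refine ⟨Derivation.liftOfSurjective hs hker, fun b => ?_, ?_⟩
  · rw [base, AlgHom.comp_apply, Derivation.liftOfSurjective_apply, hd, AlgHom.comp_apply, map_mul,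
      map_mul, map_mul, map_pow, map_pow, map_pow, incl_X0]
  · rw [Coord.y, Derivation.liftOfSurjective_apply, hdy, map_neg]
    rfl

theorem base_mem_nilSubalgebra {i : Fin 3} (hi : i ≠ 0) {D : Derivation ℂ (Coord n q) (Coord n q)}
    (hD : ∀ b, D (base n q b) = base n q (X 0 ^ n * pderiv i b)) (b : Pol3) :
    base n q b ∈ D.nilSubalgebra := by
  induction b using MvPolynomial.induction_on with
  | C c => rw [← algebraMap_eq, AlgHom.commutes]; exact Subalgebra.algebraMap_mem _ _
  | add p r hp hr => rw [map_add]; exact add_mem hp hr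
  | mul_X p j hp =>
    rw [map_mul]
    refine mul_mem hp (Derivation.mem_nilSubalgebra_iff.2 ⟨2, ?_⟩)
    rw [Function.iterate_succ_apply, Function.iterate_one, hD, hD, pderiv_X, Derivation.leibniz,
      Derivation.leibniz_pow, pderiv_X_of_ne hi.symm]
    by_cases h : j = i
    · subst h; simp
    · simp [h]

theorem exists_lnd (n : ℕ) (q : Pol3) {i j : Fin 3} (hi : i ≠ 0) (hij : j ≠ i) :
    ∃ D : Derivation ℂ (Coord n q) (Coord n q), D ≠ 0 ∧ (∀ a, ∃ k, D^[k] a = 0) ∧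
      D (base n q (X j)) = 0 := by
  obtain ⟨D, hD, hy⟩ := exists_triangular_derivation n q hi
  refine ⟨D, ?_, ?_, ?_⟩
  · rintro rfl
    have h := hD (X i)
    rw [pderiv_X_self, mul_one, map_pow] at h
    exact pow_ne_zero n base_X0_ne_zero h.symm
  · intro a
    rw [← Derivation.mem_nilSubalgebra_iff]
    have hyn : Coord.y n q ∈ D.nilSubalgebra := by
      obtain ⟨k, hk⟩ := Derivation.mem_nilSubalgebra_iff.1
        (neg_mem (base_mem_nilSubalgebra hi hD (pderiv i (centerPol q))))
      exact Derivation.mem_nilSubalgebra_iff.2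
        ⟨k + 1, by rw [Function.iterate_succ_apply, hy, hk]⟩
    obtain ⟨P, rfl⟩ := evalY_surjective a
    induction P using Polynomial.induction_on' with
    | add p r hp hr => rw [map_add]; exact add_mem hp hr
    | monomial k b =>
      rw [← Polynomial.C_mul_X_pow_eq_monomial, map_mul, map_pow, evalY_C, evalY_X]
      exact mul_mem (base_mem_nilSubalgebra hi hD b) (pow_mem hyn k)
  · rw [hD, pderiv_X_of_ne hij, mul_zero, map_zero]

variable {n₁ n₂ : ℕ} {q₁ q₂ : Pol3}

/-- An isomorphism of coordinate rings transports locally nilpotent derivations. -/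
theorem exists_lnd_conj (Ψ : Coord n₁ q₁ ≃ₐ[ℂ] Coord n₂ q₂)
    (D : Derivation ℂ (Coord n₁ q₁) (Coord n₁ q₁)) :
    ∃ D' : Derivation ℂ (Coord n₂ q₂) (Coord n₂ q₂), ∀ a, D' (Ψ a) = Ψ (D a) := by
  refine ⟨Derivation.mk' (Ψ.toLinearMap ∘ₗ D.toLinearMap ∘ₗ Ψ.symm.toLinearMap) ?_, ?_⟩
  · intro a b
    change Ψ (D (Ψ.symm (a * b))) = a • Ψ (D (Ψ.symm b)) + b • Ψ (D (Ψ.symm a))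
    simp only [map_mul, Derivation.leibniz, smul_eq_mul, map_add, AlgEquiv.apply_symm_apply]
  · intro a
    change Ψ (D (Ψ.symm (Ψ a))) = _
    rw [AlgEquiv.symm_apply_apply]

/-- Each variable is killed by the triangular derivation in the direction z or t, whichever differs
from it. Conjugated by Ψ, that derivation kills the image of the variable, and the kernel theorem
applies. -/
theorem exists_base_eq_equiv (hn : 2 ≤ n₂) (Ψ : Coord n₁ q₁ ≃ₐ[ℂ] Coord n₂ q₂) (j : Fin 3) :
    ∃ b, base n₂ q₂ b = Ψ (base n₁ q₁ (X j)) := by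
  obtain ⟨i, hi, hij⟩ : ∃ i : Fin 3, i ≠ 0 ∧ j ≠ i := by
    fin_cases j
    · exact ⟨1, by decide, by decide⟩
    · exact ⟨2, by decide, by decide⟩
    · exact ⟨1, by decide, by decide⟩
  obtain ⟨D, hD, hnil, hj⟩ := exists_lnd n₁ q₁ hi hij
  obtain ⟨D', hD'⟩ := exists_lnd_conj Ψ D
  have hit : ∀ k a, D'^[k] (Ψ a) = Ψ (D^[k] a) := fun k a =>
    ((Function.Semiconj.iterate_right (f := Ψ) (ga := D) (gb := D')
      (fun a => (hD' a).symm) k) a).symm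
  refine exists_base_eq_of_apply_eq_zero hn D' ?_ ?_ (by rw [hD', hj, map_zero])
  · rintro rfl
    apply hD
    ext a
    exact Ψ.injective (by rw [← hD']; simp)
  · intro a
    obtain ⟨a, rfl⟩ := Ψ.surjective a
    obtain ⟨k, hk⟩ := hnil a
    exact ⟨k, by rw [hit, hk, map_zero]⟩

theorem exists_algHom_base (hn : 2 ≤ n₂) (Ψ : Coord n₁ q₁ ≃ₐ[ℂ] Coord n₂ q₂) :
    ∃ φ : Pol3 →ₐ[ℂ] Pol3, ∀ b, base n₂ q₂ (φ b) = Ψ (base n₁ q₁ b) := by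
  choose c hc using exists_base_eq_equiv hn Ψ
  refine ⟨aeval c, fun b => ?_⟩
  have : (base n₂ q₂).comp (aeval c) = (Ψ : Coord n₁ q₁ →ₐ[ℂ] Coord n₂ q₂).comp (base n₁ q₁) :=
    algHom_ext fun i => by simp [hc]
  exact DFunLike.congr_fun this b

/-- Every isomorphism of the coordinate rings restricts to an automorphism of `ℂ[x, z, t]`. -/
theorem exists_algEquiv_base (hn₁ : 2 ≤ n₁) (hn₂ : 2 ≤ n₂)
    (Ψ : Coord n₁ q₁ ≃ₐ[ℂ] Coord n₂ q₂) :
    ∃ φ : Pol3 ≃ₐ[ℂ] Pol3, ∀ b, base n₂ q₂ (φ b) = Ψ (base n₁ q₁ b) := by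
  obtain ⟨φ, hφ⟩ := exists_algHom_base hn₂ Ψ
  obtain ⟨ψ, hψ⟩ := exists_algHom_base hn₁ Ψ.symm
  refine ⟨AlgEquiv.ofAlgHom φ ψ ?_ ?_, hφ⟩
  · refine AlgHom.ext fun b => base_injective (n := n₂) (q := q₂) ?_
    simp [hφ, hψ]
  · refine AlgHom.ext fun b => base_injective (n := n₁) (q := q₁) ?_
    simp [hφ, hψ]

/-! ### Divisibility by x, the exponent and the center ideal -/

theorem exists_X0_pow_mul_eq_base (a : Coord n q) :
    ∃ (N : ℕ) (b : Pol3), base n q (X 0) ^ N * a = base n q b := by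
  obtain ⟨P, rfl⟩ := evalY_surjective a
  induction P using Polynomial.induction_on' with
  | add p r hp hr =>
    obtain ⟨N, b, h⟩ := hp
    obtain ⟨M, c, h'⟩ := hr
    refine ⟨N + M, X 0 ^ M * b + X 0 ^ N * c, ?_⟩
    simp only [map_add, map_mul, map_pow, ← h, ← h']
    ring
  | monomial k b =>
    refine ⟨n * k, b * (-centerPol q) ^ k, ?_⟩
    rw [← Polynomial.C_mul_X_pow_eq_monomial, map_mul, map_pow, evalY_C, evalY_X, map_mul, map_pow,
      map_neg, ← Coord.relation]
    ring

theorem X0_not_dvd_centerPol (q : Pol3) : ¬ X 0 ∣ centerPol q := by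
  rintro ⟨r, hr⟩
  have := congrArg (eval ![0, 1, 0]) hr
  simp [centerPol] at this

theorem X0_not_dvd_equation (hn : n ≠ 0) : ¬ X 0 ∣ equation n q := by
  rintro ⟨r, hr⟩
  have := congrArg (eval ![0, 0, 1, 0]) hr
  simp [equation, hn] at this

/-- Setting `y = 0`. -/
def setY : Pol4 →ₐ[ℂ] Pol3 := aeval ![X 0, 0, X 1, X 2]

theorem setY_incl (b : Pol3) : setY (incl b) = b := by
  have : setY.comp incl = AlgHom.id ℂ Pol3 := algHom_ext fun i => by
    rw [AlgHom.comp_apply, incl_X]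
    fin_cases i <;> simp [setY]
  exact DFunLike.congr_fun this b

theorem setY_equation : setY (equation n q) = centerPol q := by
  rw [equation_eq, map_add, setY_incl, map_mul]
  simp [setY]

theorem exists_incl_eq_of_base_eq {m : ℕ} {b : Pol3} {a : Coord n q}
    (h : base n q b = base n q (X 0) ^ m * a) :
    ∃ p r, incl b = X 0 ^ m * p + equation n q * r := by
  obtain ⟨p, rfl⟩ := Ideal.Quotient.mk_surjective a
  have : Coord.mk n q (incl b - X 0 ^ m * p) = 0 := by
    rw [map_sub, map_mul, map_pow, ← incl_X0, sub_eq_zero]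
    exact h
  obtain ⟨r, hr⟩ := Ideal.mem_span_singleton.1 (Ideal.Quotient.eq_zero_iff_mem.1 this)
  exact ⟨p, r, by rw [← hr]; ring⟩

theorem exists_eq_of_base_eq {m : ℕ} {b : Pol3} {a : Coord n q}
    (h : base n q b = base n q (X 0) ^ m * a) :
    ∃ p r, b = X 0 ^ m * p + centerPol q * r := by
  obtain ⟨p, r, hpr⟩ := exists_incl_eq_of_base_eq h
  have := congrArg setY hpr
  rw [setY_incl, map_add, map_mul, map_mul, map_pow, setY_equation] at this
  refine ⟨setY p, setY r, ?_⟩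
  rwa [← incl_X0, setY_incl] at this

/-- One direction is f = -xⁿy; the other lifts to ℂ[x, y, z, t] and sets y = 0. This intrinsic
description is what isomorphisms transport. -/
theorem mem_centerIdeal_iff {b : Pol3} :
    b ∈ centerIdeal n q ↔ ∃ a, base n q b = base n q (X 0) ^ n * a := by
  rw [centerIdeal, Ideal.mem_span_pair]
  constructor
  · rintro ⟨c, d, rfl⟩
    refine ⟨base n q c - Coord.y n q * base n q d, ?_⟩
    change base n q (c * X 0 ^ n + d * centerPol q) = _
    rw [map_add, map_mul, map_mul, map_pow]
    linear_combination base n q d * Coord.relation (n := n) (q := q)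
  · rintro ⟨a, ha⟩
    obtain ⟨p, r, h⟩ := exists_eq_of_base_eq ha
    exact ⟨p, r, by rw [h, centerPol]; ring⟩

/-- Lift to b = xⁿ⁺¹p + Fr with F = xⁿy + f and differentiate in y. Since x is prime and does not
divide F, ∂_y r = xⁿs, whence r = -(x ∂_y p + Fs). Setting y = 0 leaves b in (x, f²). -/
theorem exists_eq_of_base_eq_succ (hn : n ≠ 0) {b : Pol3} {a : Coord n q}
    (h : base n q b = base n q (X 0) ^ (n + 1) * a) :
    ∃ p r, b = X 0 * p + centerPol q ^ 2 * r := by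
  obtain ⟨p, r, hpr⟩ := exists_incl_eq_of_base_eq h
  have hincl : ∀ b, pderiv 1 (incl b) = 0 := by
    intro b
    induction b using MvPolynomial.induction_on with
    | C c => simp [incl]
    | add p r hp hr => rw [map_add, map_add, hp, hr, add_zero]
    | mul_X p i hp =>
      rw [map_mul, Derivation.leibniz, hp, incl_X, pderiv_X_of_ne, smul_zero, smul_zero, add_zero]
      fin_cases i <;> decide
  have hX0 : pderiv (R := ℂ) (1 : Fin 4) (X 0) = 0 := pderiv_X_of_ne (by decide)
  have h1 := congrArg (pderiv 1) hpr
  rw [hincl, map_add, Derivation.leibniz, Derivation.leibniz, Derivation.leibniz_pow, hX0,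
    equation_eq, map_add, hincl, Derivation.leibniz, Derivation.leibniz_pow, hX0, pderiv_X_self,
    ← equation_eq] at h1
  simp only [smul_eq_mul, smul_zero, mul_zero, add_zero, mul_one] at h1
  have hdvd : X 0 ^ n ∣ equation n q * pderiv 1 r :=
    ⟨-(X 0 * pderiv 1 p + r), by linear_combination -h1⟩
  obtain ⟨s, hs⟩ := (X_prime (R := ℂ) (i := (0 : Fin 4))).pow_dvd_of_dvd_mul_left n
    (X0_not_dvd_equation hn) hdvd
  have h2 : r = -(X 0 * pderiv 1 p + equation n q * s) := by
    refine mul_left_cancel₀ (pow_ne_zero n (X_ne_zero (R := ℂ) (0 : Fin 4))) ?_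
    rw [hs] at h1
    linear_combination -h1
  have h3 := congrArg setY hpr
  rw [h2] at h3
  simp only [setY_incl, map_add, map_mul, map_pow, map_neg, setY_equation] at h3
  have hsX : setY (X 0) = X 0 := by rw [← incl_X0, setY_incl]
  rw [hsX] at h3
  refine ⟨X 0 ^ n * setY p - centerPol q * setY (pderiv 1 p), -setY s, ?_⟩
  rw [h3]
  ring

/-- The image of xⁿy = -f₁, multiplied by a power of x to clear y, shows that the prime φ(x) divides
xᴺφ(f₁). It cannot divide φ(f₁), so it divides x. -/
theorem associated_map_X0 (hn : n₁ ≠ 0) {Ψ : Coord n₁ q₁ ≃ₐ[ℂ] Coord n₂ q₂} {φ : Pol3 ≃ₐ[ℂ] Pol3}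
    (h : ∀ b, base n₂ q₂ (φ b) = Ψ (base n₁ q₁ b)) : Associated (φ (X 0)) (X 0) := by
  have hX : Prime (X 0 : Pol3) := X_prime
  have hp : Prime (φ (X 0)) := (MulEquiv.prime_iff φ).2 hX
  obtain ⟨N, b, hb⟩ := exists_X0_pow_mul_eq_base
    (base n₂ q₂ (φ (X 0)) ^ (n₁ - 1) * Ψ (Coord.y n₁ q₁))
  have h1 : X 0 ^ N * φ (centerPol q₁) = φ (X 0) * -b := by
    refine base_injective (n := n₂) (q := q₂) ?_
    have e := congrArg Ψ (Coord.relation (n := n₁) (q := q₁))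
    rw [map_mul, map_pow, map_neg, ← h, ← h, ← mul_pow_sub_one hn] at e
    rw [map_mul, map_mul, map_neg, map_pow, ← hb]
    linear_combination base n₂ q₂ (X 0) ^ N * e
  have h2 : φ (X 0) ∣ X 0 ^ N * φ (centerPol q₁) := ⟨_, h1⟩
  rcases hp.dvd_or_dvd h2 with h3 | h3
  · exact (hp.dvd_prime_iff_associated hX).1 (hp.dvd_of_dvd_pow h3)
  · exact absurd ((map_dvd_iff φ).1 h3) (X0_not_dvd_centerPol q₁)

/-- On the line x = t = 0 the equation would read z² = z⁴b. -/
theorem centerPol_ne (q a b : Pol3) : centerPol q ≠ X 0 * a + centerPol q ^ 2 * b := by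
  intro h
  have h1 := congrArg (aeval ![0, Polynomial.X, 0] : Pol3 →ₐ[ℂ] Polynomial ℂ) h
  simp [centerPol] at h1
  have h2 := congrArg (Polynomial.coeff · 2) h1
  rw [← pow_mul] at h2
  simp [Polynomial.coeff_X_pow_mul'] at h2

/-- If n₁ > n₂, then φ(f₁) is divisible by xⁿ²⁺¹ (exponent n₂ + 1) in the second ring, so φ(f₁) ∈
(x, f₂²). But φ⁻¹(f₂) ∈ (x, f₁) always, so f₂ ∈ (x, f₂²), which is impossible. -/
theorem exponent_le (hn₁ : n₁ ≠ 0) (hn₂ : n₂ ≠ 0) {Ψ : Coord n₁ q₁ ≃ₐ[ℂ] Coord n₂ q₂}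
    {φ : Pol3 ≃ₐ[ℂ] Pol3} (h : ∀ b, base n₂ q₂ (φ b) = Ψ (base n₁ q₁ b)) : n₁ ≤ n₂ := by
  by_contra! hlt
  obtain ⟨w, hw⟩ := associated_map_X0 hn₁ h
  obtain ⟨w', hw'⟩ := (associated_map_X0 hn₁ h).symm
  have h1 : ∃ a, base n₂ q₂ (φ (centerPol q₁)) = base n₂ q₂ (X 0) ^ (n₂ + 1) * a := by
    have e := congrArg Ψ (Coord.relation (n := n₁) (q := q₁))
    rw [map_mul, map_pow, map_neg, ← h, ← h, ← hw', map_mul, mul_pow,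
      ← pow_mul_pow_sub (base n₂ q₂ (X 0)) (Nat.succ_le_of_lt hlt), Nat.succ_eq_add_one] at e
    exact ⟨-(base n₂ q₂ (X 0) ^ (n₁ - (n₂ + 1)) * base n₂ q₂ w' ^ n₁ * Ψ (Coord.y n₁ q₁)),
      by linear_combination e⟩
  obtain ⟨a, ha⟩ := h1
  obtain ⟨p, r, hpr⟩ := exists_eq_of_base_eq_succ hn₂ ha
  have h2 : ∃ a, base n₁ q₁ (φ.symm (centerPol q₂)) = base n₁ q₁ (X 0) ^ 1 * a := by
    have hs : ∀ b, base n₁ q₁ (φ.symm b) = Ψ.symm (base n₂ q₂ b) := fun b => by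
      rw [AlgEquiv.eq_symm_apply, ← h, AlgEquiv.apply_symm_apply]
    have e := congrArg Ψ.symm (Coord.relation (n := n₂) (q := q₂))
    have hX : φ.symm (X 0) = X 0 * φ.symm (w : Pol3) := by
      conv_lhs => rw [← hw, map_mul, AlgEquiv.symm_apply_apply]
    rw [map_mul, map_pow, map_neg, ← hs, ← hs, hX, map_mul, mul_pow,
      ← mul_pow_sub_one hn₂ (base n₁ q₁ (X 0))] at e
    exact ⟨-(base n₁ q₁ (X 0) ^ (n₂ - 1) * base n₁ q₁ (φ.symm w) ^ n₂ *
      Ψ.symm (Coord.y n₂ q₂)), by linear_combination e⟩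
  obtain ⟨a', ha'⟩ := h2
  obtain ⟨p', r', hpr'⟩ := exists_eq_of_base_eq ha'
  have h3 := congrArg φ hpr'
  rw [AlgEquiv.apply_symm_apply, map_add, map_mul, map_mul, pow_one, hpr, ← hw'] at h3
  refine centerPol_ne q₂ (w' * φ p' + p * φ r') (r * φ r') ?_
  linear_combination h3

theorem exponent_eq (hn₁ : n₁ ≠ 0) (hn₂ : n₂ ≠ 0) {Ψ : Coord n₁ q₁ ≃ₐ[ℂ] Coord n₂ q₂}
    {φ : Pol3 ≃ₐ[ℂ] Pol3} (h : ∀ b, base n₂ q₂ (φ b) = Ψ (base n₁ q₁ b)) : n₁ = n₂ :=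
  le_antisymm (exponent_le hn₁ hn₂ h) (exponent_le hn₂ hn₁ (Ψ := Ψ.symm) (φ := φ.symm) fun b => by
    rw [AlgEquiv.eq_symm_apply, ← h, AlgEquiv.apply_symm_apply])

theorem mem_hyperplaneIdeal_iff {φ : Pol3 ≃ₐ[ℂ] Pol3} (h : Associated (φ (X 0)) (X 0)) (b : Pol3) :
    b ∈ hyperplaneIdeal ↔ φ b ∈ hyperplaneIdeal := by
  rw [hyperplaneIdeal, Ideal.mem_span_singleton, Ideal.mem_span_singleton,
    ← h.dvd_iff_dvd_left (c := φ b)]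
  exact (map_dvd_iff φ).symm

theorem exists_pow_mul_iff_of_associated {R : Type*} [CommRing R] {p x : R} (h : Associated p x)
    (b : R) (m : ℕ) : (∃ a, b = p ^ m * a) ↔ ∃ a, b = x ^ m * a :=
  (h.pow_pow (n := m)).dvd_iff_dvd_left

theorem mem_centerIdeal_iff_map (hn₁ : n₁ ≠ 0) (hn₂ : n₂ ≠ 0) {Ψ : Coord n₁ q₁ ≃ₐ[ℂ] Coord n₂ q₂}
    {φ : Pol3 ≃ₐ[ℂ] Pol3} (h : ∀ b, base n₂ q₂ (φ b) = Ψ (base n₁ q₁ b)) (b : Pol3) :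
    b ∈ centerIdeal n₁ q₁ ↔ φ b ∈ centerIdeal n₂ q₂ := by
  obtain rfl := exponent_eq hn₁ hn₂ h
  rw [mem_centerIdeal_iff, mem_centerIdeal_iff, ← exists_pow_mul_iff_of_associated
    ((associated_map_X0 hn₁ h).map (base n₁ q₂)), h, h]
  constructor
  · rintro ⟨a, ha⟩
    exact ⟨Ψ a, by rw [ha, map_mul, map_pow]⟩
  · rintro ⟨a, ha⟩
    refine ⟨Ψ.symm a, Ψ.injective ?_⟩
    rw [ha, map_mul, map_pow, AlgEquiv.apply_symm_apply]

/-- If m < n, cancelling xᵐ, which is possible because x does not divide f, puts 1 in (x, f); yet x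
and f both vanish at the origin. Thus the center ideal determines n. -/
theorem le_of_X0_pow_mem {m : ℕ} (h : X 0 ^ m ∈ centerIdeal n q) : n ≤ m := by
  by_contra! hlt
  rw [centerIdeal, Ideal.mem_span_pair] at h
  obtain ⟨a, b, hab⟩ := h
  obtain ⟨r, rfl⟩ := Nat.exists_eq_add_of_lt hlt
  have hX := X_prime (R := ℂ) (i := (0 : Fin 3))
  have hdvd : X 0 ^ m ∣ centerPol q * b :=
    ⟨1 - a * X 0 ^ (r + 1), by rw [centerPol]; linear_combination hab⟩
  obtain ⟨c, rfl⟩ := hX.pow_dvd_of_dvd_mul_left m (X0_not_dvd_centerPol q) hdvd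
  have h1 : (1 : Pol3) = a * X 0 ^ (r + 1) + c * centerPol q := by
    refine mul_left_cancel₀ (pow_ne_zero m hX.ne_zero) ?_
    rw [centerPol]
    linear_combination -hab
  have h2 := congrArg (eval 0) h1
  simp [centerPol] at h2

/-! ### Lifting automorphisms to the coordinate rings -/

theorem exists_algHom_coord {φ : Pol3 →ₐ[ℂ] Pol3} {a : Coord n₂ q₂}
    (h : base n₂ q₂ (φ (centerPol q₁)) = base n₂ q₂ (φ (X 0)) ^ n₁ * a) :
    ∃ Ψ : Coord n₁ q₁ →ₐ[ℂ] Coord n₂ q₂, ∀ b, Ψ (base n₁ q₁ b) = base n₂ q₂ (φ b) := by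
  let F : Pol4 →ₐ[ℂ] Coord n₂ q₂ :=
    aeval ![base n₂ q₂ (φ (X 0)), -a, base n₂ q₂ (φ (X 1)), base n₂ q₂ (φ (X 2))]
  have hF : ∀ b, F (incl b) = base n₂ q₂ (φ b) := by
    have : F.comp incl = (base n₂ q₂).comp φ := algHom_ext fun i => by
      rw [AlgHom.comp_apply, incl_X]
      fin_cases i <;> simp [F]
    exact fun b => DFunLike.congr_fun this b
  refine ⟨Ideal.Quotient.liftₐ _ F ?_, hF⟩
  intro p hp
  obtain ⟨r, rfl⟩ := Ideal.mem_span_singleton.1 hp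
  have : F (equation n₁ q₁) = 0 := by
    refine (congrArg F equation_eq).trans ?_
    rw [map_add, hF, h]
    simp [F]
    ring
  rw [map_mul, this, zero_mul]

theorem algHom_coord_ext {F G : Coord n₁ q₁ →ₐ[ℂ] Coord n₂ q₂}
    (hF : F (base n₁ q₁ (X 0)) ≠ 0) (h : ∀ b, F (base n₁ q₁ b) = G (base n₁ q₁ b)) : F = G := by
  have hy : F (Coord.y n₁ q₁) = G (Coord.y n₁ q₁) := by
    have h1 := congrArg F (Coord.relation (n := n₁) (q := q₁))
    have h2 := congrArg G (Coord.relation (n := n₁) (q := q₁))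
    rw [map_mul, map_pow, map_neg] at h1 h2
    rw [← h, ← h, ← h1] at h2
    exact mul_left_cancel₀ (pow_ne_zero _ hF) h2.symm
  refine AlgHom.ext fun a => ?_
  obtain ⟨P, rfl⟩ := evalY_surjective a
  induction P using Polynomial.induction_on' with
  | add p r hp hr => rw [map_add, map_add, map_add, hp, hr]
  | monomial k b =>
    rw [← Polynomial.C_mul_X_pow_eq_monomial, map_mul, map_pow, evalY_C, evalY_X]
    simp only [map_mul, map_pow, h, hy]

/-- The hypotheses give φ(x) ~ x and n₁ = n₂, so φ(f₁) is divisible by φ(x)ⁿ in the second ring and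
φ extends to y; so does φ⁻¹. The extensions are mutually inverse because the image of y is forced by
xⁿy = -f in a domain. -/
theorem exists_algEquiv_coord {φ : Pol3 ≃ₐ[ℂ] Pol3}
    (hX : ∀ b, b ∈ hyperplaneIdeal ↔ φ b ∈ hyperplaneIdeal)
    (hI : ∀ b, b ∈ centerIdeal n₁ q₁ ↔ φ b ∈ centerIdeal n₂ q₂) :
    ∃ Ψ : Coord n₁ q₁ ≃ₐ[ℂ] Coord n₂ q₂, ∀ b, base n₂ q₂ (φ b) = Ψ (base n₁ q₁ b) := by
  have hX' : ∀ b, X 0 ∣ b ↔ X 0 ∣ φ b := fun b => by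
    rw [← Ideal.mem_span_singleton, ← Ideal.mem_span_singleton]
    exact hX b
  have hass : Associated (φ (X 0)) (X 0) := by
    refine associated_of_dvd_dvd ?_ ((hX' _).1 dvd_rfl)
    have := (hX' (φ.symm (X 0))).2 (by rw [AlgEquiv.apply_symm_apply])
    simpa using map_dvd φ this
  have hass' : Associated (φ.symm (X 0)) (X 0) := by
    simpa using (hass.map φ.symm).symm
  have hX0 : ∀ m q, X 0 ^ m ∈ centerIdeal m q := fun m q => Ideal.subset_span (by simp)
  have hf : ∀ m q, centerPol q ∈ centerIdeal m q := fun m q => Ideal.subset_span (by simp [centerPol])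
  have hle : n₂ ≤ n₁ := by
    have := (hI _).1 (hX0 n₁ q₁)
    rw [map_pow] at this
    exact le_of_X0_pow_mem (Ideal.mem_of_dvd _ hass.symm.pow_pow.symm.dvd this)
  have hle' : n₁ ≤ n₂ := by
    have := (hI (φ.symm (X 0 ^ n₂))).2 (by rw [AlgEquiv.apply_symm_apply]; exact hX0 n₂ q₂)
    rw [map_pow] at this
    exact le_of_X0_pow_mem (Ideal.mem_of_dvd _ hass'.symm.pow_pow.symm.dvd this)
  obtain rfl := le_antisymm hle' hle
  have h1 := (mem_centerIdeal_iff).1 ((hI _).1 (hf n₁ q₁))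
  rw [← exists_pow_mul_iff_of_associated (hass.map (base n₁ q₂))] at h1
  have h2 := (mem_centerIdeal_iff).1 ((hI (φ.symm (centerPol q₂))).2
    (by rw [AlgEquiv.apply_symm_apply]; exact hf n₁ q₂))
  rw [← exists_pow_mul_iff_of_associated (hass'.map (base n₁ q₁))] at h2
  obtain ⟨a, ha⟩ := h1
  obtain ⟨a', ha'⟩ := h2
  obtain ⟨F, hF⟩ := exists_algHom_coord (φ := (φ : Pol3 →ₐ[ℂ] Pol3)) ha
  obtain ⟨G, hG⟩ := exists_algHom_coord (φ := (φ.symm : Pol3 →ₐ[ℂ] Pol3)) ha'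
  refine ⟨AlgEquiv.ofAlgHom F G (Eq.symm ?_) (Eq.symm ?_), fun b => (hF b).symm⟩
  · exact algHom_coord_ext base_X0_ne_zero fun b => by simp [hF, hG]
  · exact algHom_coord_ext base_X0_ne_zero fun b => by simp [hF, hG]

end AffineThreefold
end

/-! ### Translation between schemes and algebras -/

noncomputable section
namespace AffineThreefold

section Spec
variable {R S T : Type} [CommRing R] [Algebra ℂ R] [CommRing S] [Algebra ℂ S] [CommRing T]
  [Algebra ℂ T]

theorem specCMap_comp (f : R →ₐ[ℂ] S) (g : S →ₐ[ℂ] T) :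
    specCMap (g.comp f) = specCMap g ≫ specCMap f :=
  (algSpec (CommRingCat.of ℂ)).map_comp (CommAlgCat.ofHom g).op (CommAlgCat.ofHom f).op

theorem specCMap_id : specCMap (AlgHom.id ℂ R) = 𝟙 (specC R) :=
  (algSpec (CommRingCat.of ℂ)).map_id _

theorem specCMap_injective : Function.Injective (specCMap : (R →ₐ[ℂ] S) → _) := by
  intro f g h
  have : (algSpec (CommRingCat.of ℂ)).Faithful := algSpec.instFaithful
  have h1 := Quiver.Hom.op_inj ((algSpec (CommRingCat.of ℂ)).map_injective h)
  exact congrArg CommAlgCat.Hom.hom h1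

theorem specCMap_surjective : Function.Surjective (specCMap : (R →ₐ[ℂ] S) → _) := by
  intro f
  have : (algSpec (CommRingCat.of ℂ)).Full := algSpec.instFull
  obtain ⟨g, hg⟩ := (algSpec (CommRingCat.of ℂ)).map_surjective f
  exact ⟨g.unop.hom, hg⟩

theorem exists_algEquiv_of_iso (e : specC R ≅ specC S) :
    ∃ f : S ≃ₐ[ℂ] R, specCMap (f : S →ₐ[ℂ] R) = e.hom := by
  obtain ⟨f, hf⟩ := specCMap_surjective e.hom
  obtain ⟨g, hg⟩ := specCMap_surjective e.inv
  refine ⟨AlgEquiv.ofAlgHom f g ?_ ?_, hf⟩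
  · exact specCMap_injective (by rw [specCMap_comp, hf, hg, e.hom_inv_id, specCMap_id])
  · exact specCMap_injective (by rw [specCMap_comp, hf, hg, e.inv_hom_id, specCMap_id])

theorem exists_iso_of_algEquiv (f : S ≃ₐ[ℂ] R) :
    ∃ e : specC R ≅ specC S, e.hom = specCMap (f : S →ₐ[ℂ] R) :=
  ⟨⟨specCMap (f : S →ₐ[ℂ] R), specCMap (f.symm : R →ₐ[ℂ] S),
    by rw [← specCMap_comp, AlgEquiv.comp_symm, specCMap_id],
    by rw [← specCMap_comp, AlgEquiv.symm_comp, specCMap_id]⟩, rfl⟩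

end Spec

theorem mapsIsoOnto_iff {φ : A3 ≅ A3} {f : Pol3 ≃ₐ[ℂ] Pol3}
    (hf : specCMap (f : Pol3 →ₐ[ℂ] Pol3) = φ.hom) (I J : Ideal Pol3) :
    MapsIsoOnto φ I J ↔ ∀ b, b ∈ J ↔ f b ∈ I := by
  constructor
  · rintro ⟨e, he⟩
    obtain ⟨g, hg⟩ := exists_algEquiv_of_iso e
    rw [closedSubι, closedSubι, ← hf, ← hg, ← specCMap_comp, ← specCMap_comp] at he
    have h := fun b => DFunLike.congr_fun (specCMap_injective he) b
    intro b
    have hb : g (Ideal.Quotient.mk J b) = Ideal.Quotient.mk I (f b) := h b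
    rw [← Ideal.Quotient.eq_zero_iff_mem, ← Ideal.Quotient.eq_zero_iff_mem, ← hb]
    exact (map_eq_zero_iff g g.injective).symm
  · intro h
    have hIJ : I = J.map (f : Pol3 →+* Pol3) := by
      ext b
      refine Iff.trans ?_ (Ideal.mem_map_of_equiv (f : Pol3 ≃+* Pol3) b).symm
      constructor
      · intro hb
        exact ⟨f.symm b, (h _).2 (by rwa [AlgEquiv.apply_symm_apply]), f.apply_symm_apply b⟩
      · rintro ⟨c, hc, rfl⟩
        exact (h c).1 hc
    obtain ⟨e, he⟩ := exists_iso_of_algEquiv (Ideal.quotientEquivAlg J I f hIJ)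
    refine ⟨e, ?_⟩
    rw [closedSubι, closedSubι, he, ← hf, ← specCMap_comp, ← specCMap_comp]
    congr 1

theorem modif_eq (n : ℕ) (q : Pol3) : modif n q = specCMap (base n q) := by
  rw [modif, base, specCMap_comp]

theorem isLift_iff {n₁ n₂ : ℕ} {q₁ q₂ : Pol3} {Φ : V n₁ q₁ ≅ V n₂ q₂} {φ : A3 ≅ A3}
    {Ψ : Coord n₂ q₂ ≃ₐ[ℂ] Coord n₁ q₁} {f : Pol3 ≃ₐ[ℂ] Pol3}
    (hΨ : specCMap (Ψ : Coord n₂ q₂ →ₐ[ℂ] Coord n₁ q₁) = Φ.hom)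
    (hf : specCMap (f : Pol3 →ₐ[ℂ] Pol3) = φ.hom) :
    IsLift Φ φ ↔ ∀ b, base n₁ q₁ (f b) = Ψ (base n₂ q₂ b) := by
  rw [IsLift, modif_eq, modif_eq, ← hΨ, ← hf, ← specCMap_comp, ← specCMap_comp,
    specCMap_injective.eq_iff, DFunLike.ext_iff]
  exact forall_congr' fun b => eq_comm

end AffineThreefold
end

theorem mainTheorem3 (n₁ n₂ : ℕ) (hn₁ : 2 ≤ n₁) (hn₂ : 2 ≤ n₂)
    (q₁ q₂ : MvPolynomial (Fin 3) ℂ) :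
    (∀ Φ : AffineThreefold.V n₁ q₁ ≅ AffineThreefold.V n₂ q₂,
      ∃ φ : AffineThreefold.A3 ≅ AffineThreefold.A3,
        AffineThreefold.PreservesLoci φ n₁ q₁ n₂ q₂ ∧ AffineThreefold.IsLift Φ φ) ∧
    (∀ φ : AffineThreefold.A3 ≅ AffineThreefold.A3,
      AffineThreefold.PreservesLoci φ n₁ q₁ n₂ q₂ →
        ∃ Φ : AffineThreefold.V n₁ q₁ ≅ AffineThreefold.V n₂ q₂,
          AffineThreefold.IsLift Φ φ) := by
  have h₁ : n₁ ≠ 0 := by omega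
  have h₂ : n₂ ≠ 0 := by omega
  constructor
  · intro Φ
    obtain ⟨Ψ, hΨ⟩ := AffineThreefold.exists_algEquiv_of_iso Φ
    -- Pullback of functions is contravariant: Ψ goes from the ring of the second threefold to that
    -- of the first, so the indices are exchanged.
    obtain ⟨f, hf⟩ := AffineThreefold.exists_algEquiv_base hn₂ hn₁ Ψ
    obtain ⟨φ, hφ⟩ := AffineThreefold.exists_iso_of_algEquiv f
    refine ⟨φ, ⟨?_, ?_⟩, (AffineThreefold.isLift_iff hΨ hφ.symm).2 hf⟩
    · exact (AffineThreefold.mapsIsoOnto_iff hφ.symm _ _).2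
        (AffineThreefold.mem_hyperplaneIdeal_iff (AffineThreefold.associated_map_X0 h₂ hf))
    · exact (AffineThreefold.mapsIsoOnto_iff hφ.symm _ _).2
        (AffineThreefold.mem_centerIdeal_iff_map h₂ h₁ hf)
  · rintro φ ⟨hX, hI⟩
    obtain ⟨f, hf⟩ := AffineThreefold.exists_algEquiv_of_iso φ
    obtain ⟨Ψ, hΨ⟩ := AffineThreefold.exists_algEquiv_coord
      ((AffineThreefold.mapsIsoOnto_iff hf _ _).1 hX) ((AffineThreefold.mapsIsoOnto_iff hf _ _).1 hI)
    obtain ⟨Φ, hΦ⟩ := AffineThreefold.exists_iso_of_algEquiv Ψ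
    exact ⟨Φ, (AffineThreefold.isLift_iff hΦ.symm hf).2 hΨ⟩
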